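/- A \emph{truly integral F\'ary embedding} of a graph is a crossing-free straight-line drawing in the Euclidean plane in which every vertex lies on a point of $\mathbb{Z}^2$ and every edge has integer Euclidean length. Crossing-free means that distinct vertices are distinct points, no edge contains a vertex other than its endpoints, and two distinct edges meet at most in a common endpoint. A drawing lies on a grid of size $A\times B$ if its vertices lie in at most $A$ consecutive columns and at most $B$ consecutive rows of $\mathbb{Z}^2$. Theorem. Let $T=(V,E)$ be a finite tree with root $r$, with $n$ vertices, $t$ leaves (vertices without children) and depth $d$ (the largest distance of a vertex from $r$). Then $T$ has a truly integral F\'ary embedding on a grid of size $S\times S$, where $S=\frac{2\pi^2}{3}\,t\,d$ if $n\ge 2$, and $S=1$ if $n=1$ (a single vertex, $d=0$). Moreover $S\in\mathcal{O}(n^2)$, with an absolute constant. Such an embedding can be found in $\mathcal{O}(n+t^{3/2})$ time: there is a program for a random access machine with words of $\mathcal{O}(\log n)$ bits and unit-cost arithmetic, memory access and comparison that, given the root and the adjacency lists of any such tree on the vertex set $\{0,\dots,n-1\}$, halts after $\mathcal{O}(n+t^{3/2})$ steps with the coordinates of all vertices of such an embedding in its memory. -/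

import Mathlib

universe u

/-! ### Rooted trees -/

namespace RootedTree

variable {V : Type u}

/-- In the tree `G` rooted at `r`, the vertex `w` is a child of `v`. -/
def IsChild (G : SimpleGraph V) (r v w : V) : Prop :=
  G.Adj v w ∧ G.dist r w = G.dist r v + 1

/-- A leaf of a rooted tree is a vertex without children (so the root of a one-vertex tree is a
leaf, while a root of degree one is not). -/
def IsLeaf (G : SimpleGraph V) (r v : V) : Prop :=
  ∀ w, ¬ IsChild G r v w

/-- The number of leaves. -/
noncomputable def leafCount (G : SimpleGraph V) (r : V) : ℕ :=
  {v : V | IsLeaf G r v}.ncard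

/-- The depth: the largest distance of a vertex from the root. -/
noncomputable def depth [Fintype V] (G : SimpleGraph V) (r : V) : ℕ :=
  Finset.univ.sup fun v => G.dist r v

end RootedTree

/-! ### Straight-line drawings -/

namespace Drawing

variable {V : Type u}

/-- `P` places the vertices of `G` such that the straight-line drawing is crossing-free: distinct
vertices are distinct points, an edge contains no vertex other than its endpoints, and two distinct
edges meet at most in a common endpoint. -/
structure IsFary (G : SimpleGraph V) (P : V → EuclideanSpace ℝ (Fin 2)) : Prop where
  injective : Function.Injective P
  vertex_edge : ∀ ⦃u v w : V⦄, G.Adj u v → P w ∈ segment ℝ (P u) (P v) → w = u ∨ w = v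
  edge_edge : ∀ ⦃u v w x : V⦄, G.Adj u v → G.Adj w x → s(u, v) ≠ s(w, x) →
    ∀ p ∈ segment ℝ (P u) (P v) ∩ segment ℝ (P w) (P x),
      ∃ z, (z = u ∨ z = v) ∧ (z = w ∨ z = x) ∧ p = P z

/-- A grid point as a point of the Euclidean plane. -/
noncomputable def toPlane (p : ℤ × ℤ) : EuclideanSpace ℝ (Fin 2) :=
  !₂[(p.1 : ℝ), (p.2 : ℝ)]

/-- A crossing-free straight-line drawing with all vertices on grid points and all edge lengths
integers. -/
structure IsTrulyIntegralFary (G : SimpleGraph V) (pos : V → ℤ × ℤ) : Prop where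
  fary : IsFary G fun v => toPlane (pos v)
  integral : ∀ ⦃u v : V⦄, G.Adj u v → ∃ l : ℕ, dist (toPlane (pos u)) (toPlane (pos v)) = l

/-- All vertices lie on a `w × h` grid (`w` consecutive columns and `h` consecutive rows of grid
points) with `w ≤ A` and `h ≤ B`. -/
def OnGrid (pos : V → ℤ × ℤ) (A B : ℝ) : Prop :=
  ∃ w h : ℕ, (w : ℝ) ≤ A ∧ (h : ℝ) ≤ B ∧ ∃ a b : ℤ,
    ∀ v, (a ≤ (pos v).1 ∧ (pos v).1 < a + w) ∧ (b ≤ (pos v).2 ∧ (pos v).2 < b + h)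

end Drawing

/-! ### A random access machine with bounded words and a step count -/

namespace RAM

/-- The arithmetic operations of the machine. -/
inductive BinOp
  | add | sub | mul | div | mod

/-- Operations on natural numbers; subtraction is truncated and division rounds down. -/
def BinOp.eval : BinOp → ℕ → ℕ → ℕ
  | add, a, b => a + b
  | sub, a, b => a - b
  | mul, a, b => a * b
  | div, a, b => a / b
  | mod, a, b => a % b

/-- Programs, built from elementary instructions on registers `R i` and an indirectly addressed
memory `M`. -/
inductive Prog
  /-- Do nothing. -/
  | skip
  /-- `R i := k` -/
  | const (i k : ℕ)
  /-- `R i := R j o R k` -/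
  | op (o : BinOp) (i j k : ℕ)
  /-- `R i := M (R j)` -/
  | load (i j : ℕ)
  /-- `M (R i) := R j` -/
  | store (i j : ℕ)
  /-- First `p`, then `q`. -/
  | seq (p q : Prog)
  /-- If `R i < R j` then `p`, else `q`. -/
  | cond (i j : ℕ) (p q : Prog)
  /-- While `R i < R j` repeat `p`. -/
  | loop (i j : ℕ) (p : Prog)

/-- The contents of the registers and of the memory. -/
structure State where
  reg : ℕ → ℕ
  mem : ℕ → ℕ

/-- Write `x` into register `i`. -/
def State.setReg (s : State) (i x : ℕ) : State :=
  { s with reg := Function.update s.reg i x }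

/-- Write `x` into memory cell `a`. -/
def State.setMem (s : State) (a x : ℕ) : State :=
  { s with mem := Function.update s.mem a x }

/-- `Exec B p s s' T`: started in state `s`, the program `p` halts in state `s'` after `T` steps,
and every number that is written on the way is at most `B` (the word size is about `log₂ B` bits).
Every elementary instruction and every evaluation of a test takes one step. -/
inductive Exec (B : ℕ) : Prog → State → State → ℕ → Prop
  | skip (s : State) : Exec B .skip s s 1
  | const (s : State) (i k : ℕ) (h : k ≤ B) : Exec B (.const i k) s (s.setReg i k) 1
  | op (s : State) (o : BinOp) (i j k : ℕ) (h : o.eval (s.reg j) (s.reg k) ≤ B) :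
      Exec B (.op o i j k) s (s.setReg i (o.eval (s.reg j) (s.reg k))) 1
  | load (s : State) (i j : ℕ) (h : s.mem (s.reg j) ≤ B) :
      Exec B (.load i j) s (s.setReg i (s.mem (s.reg j))) 1
  | store (s : State) (i j : ℕ) (h : s.reg j ≤ B) :
      Exec B (.store i j) s (s.setMem (s.reg i) (s.reg j)) 1
  | seq {p q : Prog} {s s' s'' : State} {T T' : ℕ} (hp : Exec B p s s' T)
      (hq : Exec B q s' s'' T') : Exec B (.seq p q) s s'' (T + T')
  | cond_true {i j : ℕ} {p q : Prog} {s s' : State} {T : ℕ} (h : s.reg i < s.reg j)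
      (hp : Exec B p s s' T) : Exec B (.cond i j p q) s s' (T + 1)
  | cond_false {i j : ℕ} {p q : Prog} {s s' : State} {T : ℕ} (h : ¬ s.reg i < s.reg j)
      (hq : Exec B q s s' T) : Exec B (.cond i j p q) s s' (T + 1)
  | loop_false {i j : ℕ} {p : Prog} {s : State} (h : ¬ s.reg i < s.reg j) :
      Exec B (.loop i j p) s s 1
  | loop_true {i j : ℕ} {p : Prog} {s s' s'' : State} {T T' : ℕ} (h : s.reg i < s.reg j)
      (hp : Exec B p s s' T) (hl : Exec B (.loop i j p) s' s'' T') :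
      Exec B (.loop i j p) s s'' (T + T' + 1)

/-- The initial state: all registers are `0`, the memory holds the input from address `0` on and
is `0` elsewhere. -/
def State.init (input : List ℕ) : State where
  reg _ := 0
  mem a := input.getD a 0

/-- `adj v` lists the neighbours of `v`, each once, in arbitrary order. -/
def IsAdjLists {n : ℕ} (G : SimpleGraph (Fin n)) (adj : Fin n → List (Fin n)) : Prop :=
  ∀ v, (adj v).Nodup ∧ ∀ w, w ∈ adj v ↔ G.Adj v w

/-- The input for a graph on `Fin n` with root `r`, given by adjacency lists: the number `n`, the
root, for every `k ≤ n` the total length of the lists of the vertices below `k`, and the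
concatenation of the lists. -/
def encode {n : ℕ} (adj : Fin n → List (Fin n)) (r : Fin n) : List ℕ :=
  [n, r.val]
    ++ (List.range (n + 1)).map
        (fun k => (((List.finRange n).take k).map fun v => (adj v).length).sum)
    ++ (List.finRange n).flatMap (fun v => (adj v).map Fin.val)

/-- The output: the coordinates of vertex `v` stand in the memory cells `2 * v` and `2 * v + 1`. -/
def State.output (s : State) {n : ℕ} (v : Fin n) : ℤ × ℤ :=
  ((s.mem (2 * v.val) : ℤ), (s.mem (2 * v.val + 1) : ℤ))

end RAM

/-! ### The summatory function of the totient -/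

/-! Directing edges away from the root, draw each one as a vector in the closed first quadrant, with
`t` directions sorted by angle, one for each leaf. A preorder traversal numbers the leaves, so the
leaves below a vertex form an interval, and the edge into a vertex takes the direction of the first
leaf below it. Sibling subtrees then use disjoint intervals of directions: together with the edges
from the common parent they lie in cones that meet only in that parent. Along a path from the root
the sum of the coordinates increases strictly. These two facts exclude crossings whatever the
lengths of the vectors (`IsLayout.edge_edge`).

Integer lengths come from the Pythagorean vectors `(a² - b², 2ab)`, of length `a² + b²` and angle `2
arctan (b / a)`, which are sorted by the fraction `b / a ∈ [0, 1]`. What is needed are `t` such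
fractions with both coordinates below `N = ⌊13 t / 2⌋`. Reduced fractions are counted by totients:
every numerator is allowed for denominators up to about `√(N / 2)`, at least half of them up to
about `√N` (`Phi_add_Phi_le`). With the elementary estimate `x ^ 2 ≤ 4 * Phi x`
(`sq_le_four_mul_Phi`) this yields about `3 N / 16 > t` fractions (`le_card_values`). A path of at
most `d` edges spans at most `d (N - 1) + 1` grid lines, and `13 / 2 < 2π² / 3` leaves room for the
stated grid.

For the running time, the fractions are generated in increasing order, one after each leaf: the
successor of `B / A` is the least of `O(√N)` candidates, one for each denominator. This costs `O(t
√t)` altogether, and a depth-first search with an explicit stack needs `O(n)` further steps. The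
invariant `TraverseInv` ties the memory of the machine to the abstract drawing, and the time is
charged to the vertices (`cost`). -/

namespace TotientSum

open Finset

/-- The number of pairs `b < a ≤ x` of coprime numbers (with `0` coprime to `1` only). -/
def Phi (x : ℕ) : ℕ := ∑ a ∈ Ioc 0 x, Nat.totient a

/-- Both sides add up `φ(m)` over the pairs `(d, m)` with `d m ≤ x`; on the right they are grouped
by the product, using `∑ φ(m) = n` over `m ∣ n`. -/
theorem sum_Phi_div (x : ℕ) : ∑ d ∈ Ioc 0 x, Phi (x / d) = ∑ n ∈ Ioc 0 x, n := by
  let f : ArithmeticFunction ℕ := ⟨Nat.totient, Nat.totient_zero⟩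
  have h := ArithmeticFunction.sum_Ioc_mul_eq_sum_sum (ArithmeticFunction.zeta) f x
  have h1 : ∀ n, ((ArithmeticFunction.zeta : ArithmeticFunction ℕ) * f) n = n := by
    intro n
    have := ArithmeticFunction.coe_zeta_mul_apply (f := f) (x := n)
    simp only [ArithmeticFunction.natCoe_nat] at this
    rw [this]
    exact Nat.sum_totient n
  simp only [h1] at h
  rw [h]
  refine sum_congr rfl fun d hd => ?_
  have : d ≠ 0 := by simp at hd; omega
  simp [Phi, f, this]

theorem sum_Ioc_eq_odd_add_even (f : ℕ → ℕ) (x : ℕ) :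
    ∑ d ∈ Ioc 0 x, f d
      = ∑ i ∈ range ((x + 1) / 2), f (2 * i + 1) + ∑ d ∈ Ioc 0 (x / 2), f (2 * d) := by
  induction x with
  | zero => simp
  | succ x ih =>
    rw [sum_Ioc_succ_top (Nat.zero_le x), ih]
    rcases Nat.even_or_odd' x with ⟨k, rfl | rfl⟩
    · have h1 : (2 * k + 1 + 1) / 2 = k + 1 := by omega
      have h2 : (2 * k + 1) / 2 = k := by omega
      have h3 : 2 * k / 2 = k := by omega
      rw [h1, h2, h3, sum_range_succ]
      ring
    · have h1 : (2 * k + 1 + 1) / 2 = k + 1 := by omega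
      have h2 : (2 * k + 1) / 2 = k := by omega
      have h3 : (2 * k + 1 + 1 + 1) / 2 = k + 1 := by omega
      rw [h1, h2, h3, sum_Ioc_succ_top (Nat.zero_le k)]
      have h4 : 2 * (k + 1) = 2 * k + 1 + 1 := by ring
      rw [h4]
      ring

theorem two_mul_sum_Ioc_id (x : ℕ) : 2 * ∑ n ∈ Ioc 0 x, n = x * (x + 1) := by
  induction x with
  | zero => simp
  | succ x ih => rw [sum_Ioc_succ_top (Nat.zero_le x), mul_add, ih]; ring

/-- The even `d` in `sum_Phi_div` reproduce the same identity at `⌊x / 2⌋`. Removing them leaves a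
sum whose terms after `d = 1` are small enough to turn an upper bound for `Phi` into a lower one. -/
theorem odd_sum_Phi (x : ℕ) :
    2 * ∑ i ∈ range ((x + 1) / 2), Phi (x / (2 * i + 1)) + x / 2 * (x / 2 + 1) = x * (x + 1) := by
  have h := sum_Phi_div x
  rw [sum_Ioc_eq_odd_add_even] at h
  simp only [← Nat.div_div_eq_div_mul] at h
  rw [sum_Phi_div] at h
  rw [← two_mul_sum_Ioc_id, ← two_mul_sum_Ioc_id, ← h]
  ring

/-- The term `d = 1` alone is at most the whole sum over odd `d`. -/
theorem eight_mul_Phi_le (x : ℕ) : 8 * Phi x ≤ 3 * x ^ 2 + 4 * x + 1 := by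
  rcases Nat.eq_zero_or_pos x with rfl | hx
  · simp [Phi]
  have h := odd_sum_Phi x
  have h1 : Phi x ≤ ∑ i ∈ range ((x + 1) / 2), Phi (x / (2 * i + 1)) := by
    have := single_le_sum (f := fun i => Phi (x / (2 * i + 1))) (fun i _ => Nat.zero_le _)
      (mem_range.2 (show 0 < (x + 1) / 2 by omega))
    simpa using this
  rcases Nat.even_or_odd' x with ⟨k, rfl | rfl⟩
  · have h3 : 2 * k / 2 = k := by omega
    rw [h3] at h
    nlinarith
  · have h3 : (2 * k + 1) / 2 = k := by omega
    rw [h3] at h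
    nlinarith

/-- Telescoping, since `(2i + 3)² ≥ 4 (i + 1) (i + 2)`. -/
theorem sum_inv_odd_sq_le (k : ℕ) :
    ∑ i ∈ range k, (1 : ℝ) / (2 * (i + 1 : ℕ) + 1) ^ 2 ≤ 1 / 4 := by
  have h : ∑ i ∈ range k, (1 : ℝ) / (2 * (i + 1 : ℕ) + 1) ^ 2 ≤ 1 / 4 * (1 - 1 / ((k : ℝ) + 1)) := by
    induction k with
    | zero => simp
    | succ k ih =>
      rw [sum_range_succ]
      have : (1 : ℝ) / (2 * (k + 1 : ℕ) + 1) ^ 2 ≤ 1 / 4 * (1 / (k + 1) - 1 / (k + 1 + 1)) := by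
        have e : (1 : ℝ) / 4 * (1 / (k + 1) - 1 / (k + 1 + 1)) = 1 / (4 * (k + 1) * (k + 2)) := by
          field_simp
          ring
        rw [e]
        apply one_div_le_one_div_of_le (by positivity)
        push_cast
        nlinarith
      push_cast at *
      linarith
  refine h.trans ?_
  have : (0 : ℝ) ≤ 1 / (k + 1) := by positivity
  linarith

/-- Isolate `Phi x` in the sum over odd `d` and estimate the other terms by `eight_mul_Phi_le`. The
outcome is `8 Phi x ≥ (17/8) x² - (5/2) x`, which reaches `2 x²` at `x = 20`. -/
theorem sq_le_four_mul_Phi_of_le {x : ℕ} (hx : 20 ≤ x) : x ^ 2 ≤ 4 * Phi x := by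
  obtain ⟨m, hm⟩ : ∃ m, (x + 1) / 2 = m + 1 := ⟨(x + 1) / 2 - 1, by omega⟩
  have h := odd_sum_Phi x
  rw [hm, sum_range_succ'] at h
  simp only [mul_zero, zero_add, Nat.div_one] at h
  have hterm : ∀ i ∈ range m, (8 * Phi (x / (2 * (i + 1) + 1)) : ℝ)
      ≤ (3 * x ^ 2 + 16 * x) * (1 / (2 * (i + 1 : ℕ) + 1) ^ 2) + (x / 4 + 1) := by
    intro i _
    have h1 : (8 * Phi (x / (2 * (i + 1) + 1)) : ℝ)
        ≤ 3 * ((x / (2 * (i + 1) + 1) : ℕ) : ℝ) ^ 2 + 4 * ((x / (2 * (i + 1) + 1) : ℕ) : ℝ) + 1 := by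
      exact_mod_cast eight_mul_Phi_le (x / (2 * (i + 1) + 1))
    have h2 : ((x / (2 * (i + 1) + 1) : ℕ) : ℝ) ≤ x * (1 / (2 * (i + 1 : ℕ) + 1)) := by
      have := @Nat.cast_div_le ℝ _ _ _ x (2 * (i + 1) + 1)
      push_cast at *
      rw [mul_one_div]
      exact this
    rw [← one_div_pow]
    set e : ℝ := 1 / (2 * (i + 1 : ℕ) + 1)
    have h0 : (0 : ℝ) ≤ ((x / (2 * (i + 1) + 1) : ℕ) : ℝ) := by positivity
    set y : ℝ := ((x / (2 * (i + 1) + 1) : ℕ) : ℝ)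
    have hx0 : (0 : ℝ) ≤ x := by positivity
    have h3 : y ^ 2 ≤ (x * e) ^ 2 := by gcongr
    -- The hint says `4 e ≤ 16 e² + 1/4`. It trades the term `4 x e`, whose sum would be harmonic,
    -- for a multiple of the convergent sum of `e²` and the constant `x / 4`.
    nlinarith [mul_nonneg hx0 (sq_nonneg (8 * e - 1))]
  have hsum := sum_le_sum hterm
  rw [sum_add_distrib, ← mul_sum, sum_const, card_range, nsmul_eq_mul, ← mul_sum] at hsum
  have hs := sum_inv_odd_sq_le m
  have hmx : (m : ℝ) ≤ x / 2 := by
    have : 2 * m ≤ x := by omega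
    have : (2 * m : ℝ) ≤ x := by exact_mod_cast this
    linarith
  have hx' : (20 : ℝ) ≤ x := by exact_mod_cast hx
  have hhalf : ((x / 2 : ℕ) : ℝ) ≤ x / 2 := by
    have := @Nat.cast_div_le ℝ _ _ _ x 2
    push_cast at this
    exact this
  have h0 : (0 : ℝ) ≤ ((x / 2 : ℕ) : ℝ) := by positivity
  have hR : (2 * (∑ i ∈ range m, (Phi (x / (2 * (i + 1) + 1)) : ℝ) + Phi x)
      + ((x / 2 : ℕ) : ℝ) * (((x / 2 : ℕ) : ℝ) + 1)) = x * (x + 1) := by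
    exact_mod_cast h
  have hp1 : (3 * (x : ℝ) ^ 2 + 16 * x) * ∑ i ∈ range m, (1 : ℝ) / (2 * (i + 1 : ℕ) + 1) ^ 2
      ≤ (3 * (x : ℝ) ^ 2 + 16 * x) * (1 / 4) := by gcongr
  have hp2 : (m : ℝ) * (x / 4 + 1) ≤ x / 2 * (x / 4 + 1) := by gcongr
  have hp3 : ((x / 2 : ℕ) : ℝ) * (((x / 2 : ℕ) : ℝ) + 1) ≤ x / 2 * (x / 2 + 1) := by gcongr
  have : ((x : ℝ)) ^ 2 ≤ 4 * Phi x := by nlinarith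
  exact_mod_cast this

theorem sq_le_four_mul_Phi (x : ℕ) : x ^ 2 ≤ 4 * Phi x := by
  rcases le_or_gt 20 x with hx | hx
  · exact sq_le_four_mul_Phi_of_le hx
  · have : ∀ y < 20, y ^ 2 ≤ 4 * Phi y := by decide +kernel
    exact this x hx

end TotientSum

/-! ### Enumerating fractions in increasing order -/

namespace Fractions

open Finset TotientSum

/-- The fraction `b / a ∈ [0, 1]` yields a Pythagorean vector `(a² - b², 2ab)` with coordinates
below `N`. -/
structure Admissible (N a b : ℕ) : Prop where
  pos : 0 < a
  sq_lt : a * a < N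
  le : b ≤ a
  mul_lt : 2 * (a * b) < N

/-- Improve `best` by the smallest fraction with denominator `a` that exceeds `B / A`. -/
def searchStep (N A B : ℕ) (best : ℕ × ℕ) (a : ℕ) : ℕ × ℕ :=
  if B * a / A + 1 < a + 1 ∧ 2 * (a * (B * a / A + 1)) < N ∧
      (B * a / A + 1) * best.1 < best.2 * a then (a, B * a / A + 1) else best

/-- The denominator and numerator of the smallest admissible fraction above `B / A` with
denominator at most `k`; the pair `(0, 1)` (for `∞`) if there is none. -/
def search (N A B : ℕ) : ℕ → ℕ × ℕ
  | 0 => (0, 1)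
  | k + 1 => searchStep N A B (search N A B k) (k + 1)

/-- The smallest admissible fraction above a given one. -/
def next (N : ℕ) (f : ℕ × ℕ) : ℕ × ℕ := search N f.1 f.2 (Nat.sqrt (N - 1))

/-- The admissible fractions in increasing order, as pairs of denominator and numerator. -/
def enum (N : ℕ) : ℕ → ℕ × ℕ
  | 0 => (1, 0)
  | k + 1 => next N (enum N k)

theorem search_bounds (N A B k : ℕ) :
    (search N A B k).1 ≤ k ∧ (search N A B k).2 ≤ (search N A B k).1 + 1 := by
  induction k with
  | zero => simp [search]
  | succ k ih =>
    simp only [search, searchStep]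
    split_ifs with h
    · exact ⟨le_rfl, by simp; omega⟩
    · exact ⟨ih.1.trans (Nat.le_succ k), ih.2⟩

theorem search_mem (N A B k : ℕ) (hA : 0 < A) :
    search N A B k = (0, 1) ∨
      (0 < (search N A B k).1 ∧ (search N A B k).2 ≤ (search N A B k).1 ∧
        2 * ((search N A B k).1 * (search N A B k).2) < N ∧
        B * (search N A B k).1 < (search N A B k).2 * A) := by
  induction k with
  | zero => simp [search]
  | succ k ih =>
    simp only [search, searchStep]
    split_ifs with h
    · right
      refine ⟨by simp, by simp; omega, h.2.1, ?_⟩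
      simp only
      rw [mul_comm _ A]
      exact Nat.lt_mul_div_succ _ hA
    · exact ih

/-- For each denominator only the least numerator above `B / A` matters: if any larger one passes
the bounds, so does this one. A running minimum over the denominators is therefore a minimum over
all candidates. -/
theorem search_le (N A B k : ℕ) (hA : 0 < A) {a b : ℕ} (ha : 0 < a) (hak : a ≤ k) (hba : b ≤ a)
    (hN : 2 * (a * b) < N) (hlt : B * a < b * A) :
    (search N A B k).2 * a ≤ b * (search N A B k).1 := by
  induction k generalizing a b with
  | zero => omega
  | succ k ih =>
    simp only [search, searchStep]
    have hdiv : ∀ {a b : ℕ}, B * a < b * A → B * a / A + 1 ≤ b := fun h => by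
      have := (Nat.div_lt_iff_lt_mul hA).2 h
      omega
    rcases Nat.lt_or_ge k a with hk | hk
    · have hak' : a = k + 1 := by omega
      subst hak'
      have hb := hdiv hlt
      split_ifs with h
      · exact Nat.mul_le_mul_right _ hb
      · have h1 : B * (k + 1) / A + 1 < k + 1 + 1 := by omega
        have h2 : 2 * ((k + 1) * (B * (k + 1) / A + 1)) < N :=
          lt_of_le_of_lt (by gcongr) hN
        have h3 : (search N A B k).2 * (k + 1)
            ≤ (B * (k + 1) / A + 1) * (search N A B k).1 := by
          by_contra h3
          exact h ⟨h1, h2, not_le.1 h3⟩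
        exact h3.trans (Nat.mul_le_mul_right _ hb)
    · have hr := ih ha hk hba hN hlt
      split_ifs with h
      · obtain ⟨-, -, h3⟩ := h
        simp only
        rcases Nat.eq_zero_or_pos (search N A B k).1 with h0 | h0
        -- Cancelling the denominator of the previous best requires it to be positive. If it were
        -- `0`, the previous best would be `∞`, and `hr` would read `a ≤ 0`.
        · rcases search_mem N A B k hA with h4 | h4
          · rw [h4] at hr
            simp at hr
            omega
          · omega
        · have h5 : (B * (k + 1) / A + 1) * a * (search N A B k).1
              ≤ b * (k + 1) * (search N A B k).1 := by
            calc (B * (k + 1) / A + 1) * a * (search N A B k).1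
                = ((B * (k + 1) / A + 1) * (search N A B k).1) * a := by ring
              _ ≤ ((search N A B k).2 * (k + 1)) * a := Nat.mul_le_mul_right _ h3.le
              _ = ((search N A B k).2 * a) * (k + 1) := by ring
              _ ≤ (b * (search N A B k).1) * (k + 1) := Nat.mul_le_mul_right _ hr
              _ = b * (k + 1) * (search N A B k).1 := by ring
          exact Nat.le_of_mul_le_mul_right h5 h0
      · exact hr

theorem le_sqrt_pred {N a : ℕ} : a ≤ Nat.sqrt (N - 1) ∧ 0 < a ↔ a * a < N ∧ 0 < a := by
  rw [Nat.le_sqrt]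
  constructor
  · rintro ⟨h, h0⟩
    have : 0 < a * a := Nat.mul_pos h0 h0
    omega
  · rintro ⟨h, h0⟩
    omega

/-- The values of the admissible fractions. -/
def values (N : ℕ) : Finset ℚ :=
  (((range (N + 1)) ×ˢ (range (N + 1))).filter fun p =>
    0 < p.1 ∧ p.1 * p.1 < N ∧ p.2 ≤ p.1 ∧ 2 * (p.1 * p.2) < N).image fun p => (p.2 : ℚ) / p.1

theorem mem_values {N : ℕ} {q : ℚ} :
    q ∈ values N ↔ ∃ a b : ℕ, Admissible N a b ∧ (b : ℚ) / a = q := by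
  simp only [values, mem_image, mem_filter, mem_product, mem_range, Prod.exists]
  constructor
  · rintro ⟨a, b, ⟨_, h1, h2, h3, h4⟩, h⟩
    exact ⟨a, b, ⟨h1, h2, h3, h4⟩, h⟩
  · rintro ⟨a, b, h, hq⟩
    have := h.sq_lt
    have := h.le
    have : a ≤ a * a := Nat.le_mul_self a
    exact ⟨a, b, ⟨⟨by omega, by omega⟩, h.pos, h.sq_lt, h.le, h.mul_lt⟩, hq⟩

theorem next_spec {N A B : ℕ} (hA : 0 < A)
    (h : ∃ q ∈ values N, (B : ℚ) / A < q) :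
    Admissible N (next N (A, B)).1 (next N (A, B)).2 ∧
      (B : ℚ) / A < (next N (A, B)).2 / (next N (A, B)).1 ∧
      ∀ q ∈ values N, (B : ℚ) / A < q → ((next N (A, B)).2 : ℚ) / (next N (A, B)).1 ≤ q := by
  have hAQ : (0 : ℚ) < A := by exact_mod_cast hA
  have key : ∀ q ∈ values N, (B : ℚ) / A < q → ∃ a b : ℕ, 0 < a ∧ (b : ℚ) / a = q ∧
      (next N (A, B)).2 * a ≤ b * (next N (A, B)).1 := by
    intro q hq hlt
    obtain ⟨a, b, hab, rfl⟩ := mem_values.1 hq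
    have ha : (0 : ℚ) < a := by exact_mod_cast hab.pos
    rw [div_lt_div_iff₀ hAQ ha] at hlt
    refine ⟨a, b, hab.pos, rfl, ?_⟩
    exact search_le N A B _ hA hab.pos (le_sqrt_pred.2 ⟨hab.sq_lt, hab.pos⟩).1 hab.le hab.mul_lt
      (by exact_mod_cast hlt)
  rcases search_mem N A B (Nat.sqrt (N - 1)) hA with h0 | ⟨h1, h2, h3, h4⟩
  · obtain ⟨q, hq, hlt⟩ := h
    obtain ⟨a, b, ha, -, hab⟩ := key q hq hlt
    simp only [next, h0] at hab
    omega
  · change 0 < (next N (A, B)).1 at h1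
    have h1Q : (0 : ℚ) < (next N (A, B)).1 := by exact_mod_cast h1
    refine ⟨⟨h1, ?_, h2, h3⟩, ?_, ?_⟩
    · exact (le_sqrt_pred.1 ⟨(search_bounds N A B _).1, h1⟩).1
    · rw [div_lt_div_iff₀ hAQ h1Q]
      exact_mod_cast h4
    · intro q hq hlt
      obtain ⟨a, b, ha, rfl, hab⟩ := key q hq hlt
      have ha : (0 : ℚ) < a := by exact_mod_cast ha
      rw [div_le_div_iff₀ h1Q ha]
      exact_mod_cast hab

/-- By minimality each step passes over no value except the one it lists. So at least `t - (k + 1)`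
values still lie ahead, and the search cannot fail before `t` fractions are listed. -/
theorem enum_spec {N t : ℕ} (hN : 1 < N) (ht : t ≤ (values N).card) {k : ℕ} (hk : k < t) :
    Admissible N (enum N k).1 (enum N k).2 ∧
      t ≤ k + 1 + ((values N).filter fun q => ((enum N k).2 : ℚ) / (enum N k).1 < q).card := by
  induction k with
  | zero =>
    refine ⟨⟨by simp [enum], by simpa [enum] using hN, by simp [enum], by simp [enum]; omega⟩, ?_⟩
    have hsub : values N ⊆ insert 0 ((values N).filter fun q => (0 : ℚ) < q) := by
      intro q hq
      rw [mem_insert, mem_filter]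
      obtain ⟨a, b, -, rfl⟩ := mem_values.1 hq
      rcases (show (0 : ℚ) ≤ b / a by positivity).eq_or_lt with h | h
      · exact Or.inl h.symm
      · exact Or.inr ⟨hq, h⟩
    have := card_le_card hsub
    have := card_insert_le (0 : ℚ) ((values N).filter fun q => (0 : ℚ) < q)
    simp only [enum, Nat.cast_zero, zero_div]
    omega
  | succ k ih =>
    obtain ⟨hadm, hcard⟩ := ih (by omega)
    have hne : ((values N).filter fun q => ((enum N k).2 : ℚ) / (enum N k).1 < q).Nonempty := by
      rw [← card_pos]
      omega
    obtain ⟨q, hq⟩ := hne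
    rw [mem_filter] at hq
    obtain ⟨h1, h2, h3⟩ := next_spec hadm.pos ⟨q, hq⟩
    refine ⟨h1, ?_⟩
    change t ≤ k + 1 + 1 +
      ((values N).filter fun q => ((next N (enum N k)).2 : ℚ) / (next N (enum N k)).1 < q).card
    have hsub : ((values N).filter fun q => ((enum N k).2 : ℚ) / (enum N k).1 < q) ⊆
        insert (((next N (enum N k)).2 : ℚ) / (next N (enum N k)).1)
          ((values N).filter fun q => ((next N (enum N k)).2 : ℚ) / (next N (enum N k)).1 < q) := by
      intro q hq
      rw [mem_filter] at hq
      rw [mem_insert, mem_filter]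
      rcases (h3 q hq.1 hq.2).eq_or_lt with h | h
      · exact Or.inl h.symm
      · exact Or.inr ⟨hq.1, h⟩
    have := card_le_card hsub
    have := card_insert_le (((next N (enum N k)).2 : ℚ) / (next N (enum N k)).1)
          ((values N).filter fun q => ((next N (enum N k)).2 : ℚ) / (next N (enum N k)).1 < q)
    omega

theorem enum_admissible {N t : ℕ} (hN : 1 < N) (ht : t ≤ (values N).card) {k : ℕ} (hk : k < t) :
    Admissible N (enum N k).1 (enum N k).2 := (enum_spec hN ht hk).1

theorem enum_lt_succ {N t : ℕ} (hN : 1 < N) (ht : t ≤ (values N).card) {k : ℕ} (hk : k + 1 < t) :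
    ((enum N k).2 : ℚ) / (enum N k).1 < (enum N (k + 1)).2 / (enum N (k + 1)).1 := by
  obtain ⟨hadm, hcard⟩ := enum_spec hN ht (show k < t by omega)
  have hne : ((values N).filter fun q => ((enum N k).2 : ℚ) / (enum N k).1 < q).Nonempty := by
    rw [← card_pos]
    omega
  obtain ⟨q, hq⟩ := hne
  rw [mem_filter] at hq
  exact (next_spec hadm.pos ⟨q, hq⟩).2.1

theorem enum_lt {N t : ℕ} (hN : 1 < N) (ht : t ≤ (values N).card) {i j : ℕ} (hij : i < j)
    (hj : j < t) : ((enum N i).2 : ℚ) / (enum N i).1 < (enum N j).2 / (enum N j).1 := by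
  induction j with
  | zero => omega
  | succ j ih =>
    have h := enum_lt_succ hN ht hj
    rcases Nat.lt_succ_iff_lt_or_eq.1 hij with h1 | rfl
    · exact (ih h1 (by omega)).trans h
    · exact h

/-- No restriction on `k`: after the last leaf the machine searches once more, possibly in vain, and
its numbers must stay bounded then too. The `+ 1` is needed only for `N = 0`. -/
theorem enum_bounds (N k : ℕ) : (enum N k).1 ≤ N + 1 ∧ (enum N k).2 ≤ N + 1 := by
  cases k with
  | zero => simp [enum]
  | succ k =>
    have h := search_bounds N (enum N k).1 (enum N k).2 (Nat.sqrt (N - 1))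
    have h' := Nat.sqrt_le_self (N - 1)
    change (search N (enum N k).1 (enum N k).2 (Nat.sqrt (N - 1))).1 ≤ _ ∧
      (search N (enum N k).1 (enum N k).2 (Nat.sqrt (N - 1))).2 ≤ _
    rcases Nat.eq_zero_or_pos N with rfl | hN
    · simp [search]
    · omega

/-! ### There are enough admissible fractions -/

/-- The reflection `b ↦ a - b` preserves coprimality to `a` and maps the numerators above `a / 2`
into the lower half. -/
theorem totient_le_two_mul_card (a : ℕ) :
    Nat.totient a ≤ 2 * ((range a).filter fun b => a.Coprime b ∧ 2 * b ≤ a).card := by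
  have h1 : Nat.totient a = ((range a).filter fun b => a.Coprime b ∧ 2 * b ≤ a).card
      + ((range a).filter fun b => a.Coprime b ∧ ¬ 2 * b ≤ a).card := by
    rw [Nat.totient_eq_card_coprime, ← filter_filter, ← filter_filter,
      card_filter_add_card_filter_not]
  have h2 : ((range a).filter fun b => a.Coprime b ∧ ¬ 2 * b ≤ a).card
      ≤ ((range a).filter fun b => a.Coprime b ∧ 2 * b ≤ a).card := by
    apply card_le_card_of_injOn fun b => a - b
    · intro b hb
      simp only [coe_filter, mem_range, Set.mem_ofPred_eq] at hb ⊢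
      refine ⟨by omega, ?_, by omega⟩
      exact (Nat.coprime_self_sub_right hb.1.le).2 hb.2.1
    · intro b hb c hc h
      simp only [coe_filter, mem_range, Set.mem_ofPred_eq] at hb hc h
      omega
  omega

/-- Distinct reduced fractions have distinct values. A denominator `a ≤ k` admits every `b < a`, as
`2ab ≤ 2a² < N`; a denominator `a ≤ m` still admits `b ≤ a / 2`, as then `2ab ≤ a² < N`. Twice the
count is thus at least the sum of `2 φ(a)` over `a ≤ k` and of `φ(a)` over `k < a ≤ m`. -/
theorem Phi_add_Phi_le (N m k : ℕ) (hkm : k ≤ m) (hm : m * m < N) (hk : 2 * (k * k) < N) :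
    Phi m + Phi k ≤ 2 * (values N).card := by
  let S : Finset ((_ : ℕ) × ℕ) := (Ioc 0 m).sigma fun a =>
    (range a).filter fun b => a.Coprime b ∧ (a ≤ k ∨ 2 * b ≤ a)
  have hS : S.card ≤ (values N).card := by
    apply card_le_card_of_injOn fun p => (p.2 : ℚ) / p.1
    · rintro ⟨a, b⟩ hab
      simp only [S, coe_sigma, Set.mem_sigma_iff, coe_Ioc, Set.mem_Ioc, coe_filter, mem_range,
        Set.mem_ofPred_eq] at hab
      obtain ⟨⟨h1, h2⟩, h3, -, h4⟩ := hab
      apply mem_coe.2 (mem_values.2 ⟨a, b, ⟨h1, ?_, h3.le, ?_⟩, rfl⟩)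
      · exact lt_of_le_of_lt (Nat.mul_le_mul h2 h2) hm
      · rcases h4 with h4 | h4
        · exact lt_of_le_of_lt (by gcongr; omega) hk
        · calc 2 * (a * b) = a * (2 * b) := by ring
            _ ≤ m * m := by gcongr; omega
            _ < N := hm
    · rintro ⟨a, b⟩ hab ⟨c, d⟩ hcd h
      simp only [S, coe_sigma, Set.mem_sigma_iff, coe_Ioc, Set.mem_Ioc, coe_filter, mem_range,
        Set.mem_ofPred_eq] at hab hcd h
      have ha : ((a : ℤ)) ≠ 0 := by omega
      have hc : ((c : ℤ)) ≠ 0 := by omega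
      have h' : ((b : ℤ) : ℚ) / ((a : ℤ) : ℚ) = ((d : ℤ) : ℚ) / ((c : ℤ) : ℚ) := by
        push_cast
        exact h
      have hab' := hab.2.2.1.symm
      have hcd' := hcd.2.2.1.symm
      obtain ⟨e1, e2⟩ := Rat.div_int_inj (by omega) (by omega) (by simpa using hab')
        (by simpa using hcd') h'
      simp only [Int.natCast_inj] at e1 e2
      subst e1 e2
      rfl
  refine le_trans ?_ (Nat.mul_le_mul_left 2 hS)
  rw [card_sigma, mul_sum]
  have hPk : Phi k = ∑ a ∈ Ioc 0 m, if a ≤ k then Nat.totient a else 0 := by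
    rw [← sum_filter, Phi]
    congr 1
    ext a
    simp only [mem_Ioc, mem_filter]
    omega
  rw [hPk, Phi, ← sum_add_distrib]
  refine sum_le_sum fun a _ => ?_
  split_ifs with h
  · simp [h, Nat.totient_eq_card_coprime, two_mul]
  · simpa [h] using totient_le_two_mul_card a

/-- With `m ≈ √N` and `k ≈ √(N / 2)` the totient sums give about `3 N / 8 = 39 t / 16`, where `2 t`
is needed. The surplus absorbs the rounding of the square roots for `t ≥ 40`; smaller `t` are
evaluated. -/
theorem le_card_values {t : ℕ} (ht : 0 < t) : t ≤ (values (13 * t / 2)).card := by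
  set N := 13 * t / 2 with hN
  have hm := Nat.sqrt_le (N - 1)
  have hk := Nat.sqrt_le ((N - 1) / 2)
  have hm' := Nat.lt_succ_sqrt (N - 1)
  have hk' := Nat.lt_succ_sqrt ((N - 1) / 2)
  have hkm : Nat.sqrt ((N - 1) / 2) ≤ Nat.sqrt (N - 1) := Nat.sqrt_le_sqrt (by omega)
  have h := Phi_add_Phi_le N (Nat.sqrt (N - 1)) (Nat.sqrt ((N - 1) / 2)) hkm (by omega) (by omega)
  suffices 2 * t ≤ Phi (Nat.sqrt (N - 1)) + Phi (Nat.sqrt ((N - 1) / 2)) by omega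
  rcases Nat.lt_or_ge t 40 with h40 | h40
  · have : ∀ t < 40, 2 * t ≤
        Phi (Nat.sqrt (13 * t / 2 - 1)) + Phi (Nat.sqrt ((13 * t / 2 - 1) / 2)) := by
      decide +kernel
    exact this t h40
  · have h1 := sq_le_four_mul_Phi (Nat.sqrt (N - 1))
    have h2 := sq_le_four_mul_Phi (Nat.sqrt ((N - 1) / 2))
    generalize Nat.sqrt (N - 1) = m at *
    generalize Nat.sqrt ((N - 1) / 2) = k at *
    have e1 : 2 * ((m + 1) * (m + 1)) ≥ 13 * t - 1 := by simp only [Nat.succ_eq_add_one] at *; omega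
    have e2 : 4 * ((k + 1) * (k + 1)) ≥ 13 * t - 1 := by simp only [Nat.succ_eq_add_one] at *; omega
    have e3 : 2 * (m * m) ≤ 13 * t := by omega
    have e4 : 4 * (k * k) ≤ 13 * t := by omega
    suffices 8 * t ≤ m ^ 2 + k ^ 2 by omega
    zify [show 1 ≤ 13 * t by omega] at *
    -- `16` and `11` are close to `√260` and `√130`, the sizes of `m` and `k` at `t = 40`, the
    -- smallest case treated here.
    nlinarith [sq_nonneg ((m : ℤ) - 16), sq_nonneg ((k : ℤ) - 11)]

end Fractions

/-! ### Basic facts about rooted trees -/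

namespace RootedTree

variable {V : Type u} {G : SimpleGraph V} {r : V}

theorem isChild_or_isChild (hG : G.IsTree) {u v : V} (h : G.Adj u v) :
    IsChild G r u v ∨ IsChild G r v u := by
  rcases hG.dist_eq_dist_add_one_of_adj r h with h' | h'
  · exact Or.inr ⟨h.symm, h'⟩
  · exact Or.inl ⟨h, h'⟩

/-- Shortest paths from the root to the two parents, each prolonged to `c`, are paths with the same
ends, hence equal in a tree. -/
theorem IsChild.parent_unique (hG : G.IsTree) {p q c : V} (hp : IsChild G r p c)
    (hq : IsChild G r q c) : p = q := by
  obtain ⟨P, hP, hPl⟩ := hG.connected.exists_path_of_dist r p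
  obtain ⟨Q, hQ, hQl⟩ := hG.connected.exists_path_of_dist r q
  have hc : ∀ {p : V} (P : G.Walk r p), P.length = G.dist r p → IsChild G r p c →
      c ∉ P.support := by
    intro p P hPl hp hc
    classical
    have h1 := SimpleGraph.dist_le (P.takeUntil c hc)
    have h2 := P.length_takeUntil_le_length hc
    have := hp.2
    omega
  have h1 : (P.concat hp.1).IsPath := hP.concat (hc P hPl hp) hp.1
  have h2 : (Q.concat hq.1).IsPath := hQ.concat (hc Q hQl hq) hq.1
  have h := (hG.existsUnique_path r c).unique h1 h2
  have := congrArg SimpleGraph.Walk.penultimate h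
  simpa using this

theorem exists_isChild (hG : G.IsTree) {c : V} (hc : c ≠ r) : ∃ p, IsChild G r p c := by
  obtain ⟨P, hP, hPl⟩ := hG.connected.exists_path_of_dist r c
  have hnil : ¬ P.Nil := SimpleGraph.Walk.not_nil_of_ne (Ne.symm hc)
  have hadj := P.adj_penultimate hnil
  refine ⟨P.penultimate, hadj, ?_⟩
  have h1 := SimpleGraph.dist_le P.dropLast
  have h2 : P.dropLast.length + 1 = P.length := by
    rw [SimpleGraph.Walk.length_dropLast_add_one hnil]
  rcases hG.dist_eq_dist_add_one_of_adj r hadj with h' | h'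
  · omega
  · exact h'

theorem not_isChild_root (p : V) : ¬ IsChild G r p r := by
  rintro ⟨-, h⟩
  simp at h

/-- `u` lies in the subtree of `v`. -/
abbrev Desc (G : SimpleGraph V) (r : V) : V → V → Prop := Relation.ReflTransGen (IsChild G r)

theorem desc_root (hG : G.IsTree) (v : V) : Desc G r r v := by
  induction h : G.dist r v generalizing v with
  | zero =>
    rw [hG.connected.dist_eq_zero_iff] at h
    exact h ▸ .refl
  | succ k ih =>
    have hv : v ≠ r := by
      rintro rfl
      simp at h
    obtain ⟨p, hp⟩ := exists_isChild hG hv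
    exact (ih p (by have := hp.2; omega)).tail hp

/-- In the third case `q` is the vertex where the paths from the root to `u` and to `v` part. The
induction follows the path to `u` and records when it leaves the path to `v`. -/
theorem desc_trichotomy (hG : G.IsTree) (u v : V) :
    Desc G r u v ∨ Desc G r v u ∨ ∃ q e e', IsChild G r q e ∧ IsChild G r q e' ∧ e ≠ e' ∧
      Desc G r e u ∧ Desc G r e' v := by
  induction desc_root (r := r) hG u with
  | refl => exact Or.inl (desc_root hG v)
  | @tail u x hu hx ih =>
    rcases ih with h | h | ⟨q, e, e', h1, h2, h3, h4, h5⟩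
    · rcases h.cases_head with rfl | ⟨e', he, h'⟩
      · exact Or.inr (Or.inl (.single hx))
      · by_cases hxe : x = e'
        · exact Or.inl (hxe ▸ h')
        · exact Or.inr (Or.inr ⟨u, x, e', hx, he, hxe, .refl, h'⟩)
    · exact Or.inr (Or.inl (h.tail hx))
    · exact Or.inr (Or.inr ⟨q, e, e', h1, h2, h3, h4.tail hx, h5⟩)

theorem Desc.of_isChild (hG : G.IsTree) {e p c : V} (h : Desc G r e c) (hp : IsChild G r p c) :
    e = c ∨ Desc G r e p := by
  rcases h.cases_tail with h | ⟨p', h1, h2⟩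
  · exact Or.inl h.symm
  · exact Or.inr (hp.parent_unique hG h2 ▸ h1)

end RootedTree

/-! ### Drawing the edges of a rooted tree in directions sorted by the leaves -/

namespace Drawing

open RootedTree

variable {V : Type u} {G : SimpleGraph V} {r : V}

/-- Every vertex `v` owns an interval `[lo v, lo v + len v)` of directions, the intervals of its
children are disjoint subintervals, and the edge from its parent is drawn as the vector
`w (lo v)`, where the vectors `w k` with `k < t` lie in the closed first quadrant and are sorted
by their angles. -/
structure IsLayout (G : SimpleGraph V) (r : V) (t : ℕ) (w : ℕ → ℤ × ℤ) (lo len : V → ℕ)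
    (pos : V → ℤ × ℤ) : Prop where
  fst_nonneg : ∀ k < t, 0 ≤ (w k).1
  snd_nonneg : ∀ k < t, 0 ≤ (w k).2
  add_pos : ∀ k < t, 0 < (w k).1 + (w k).2
  cross_pos : ∀ i j, i < j → j < t → 0 < (w i).1 * (w j).2 - (w i).2 * (w j).1
  pos_child : ∀ p c, IsChild G r p c → pos c = pos p + w (lo c)
  len_pos : ∀ v, 0 < len v
  le_total : ∀ v, lo v + len v ≤ t
  nested : ∀ p c, IsChild G r p c → lo p ≤ lo c ∧ lo c + len c ≤ lo p + len p
  disjoint : ∀ p c c', IsChild G r p c → IsChild G r p c' → c ≠ c' →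
    lo c + len c ≤ lo c' ∨ lo c' + len c' ≤ lo c

/-! ### Cones of directions and the absence of crossings -/

/-- The vector `(x, y)` lies in the cone of the directions `i, …, j - 1`. -/
structure InCone (t : ℕ) (w : ℕ → ℤ × ℤ) (i j : ℕ) (x y : ℝ) : Prop where
  fst_nonneg : 0 ≤ x
  snd_nonneg : 0 ≤ y
  left : ∀ k < t, k ≤ i → 0 ≤ ((w k).1 : ℝ) * y - (w k).2 * x
  right : ∀ k < t, j ≤ k + 1 → 0 ≤ x * ((w k).2 : ℝ) - y * (w k).1

theorem InCone.zero (t : ℕ) (w : ℕ → ℤ × ℤ) (i j : ℕ) : InCone t w i j 0 0 := by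
  constructor <;> simp

theorem InCone.add {t : ℕ} {w : ℕ → ℤ × ℤ} {i j : ℕ} {x y x' y' : ℝ} (h : InCone t w i j x y)
    (h' : InCone t w i j x' y') : InCone t w i j (x + x') (y + y') where
  fst_nonneg := add_nonneg h.1 h'.1
  snd_nonneg := add_nonneg h.2 h'.2
  left k hk hi := by linarith [h.left k hk hi, h'.left k hk hi]
  right k hk hi := by linarith [h.right k hk hi, h'.right k hk hi]

theorem InCone.smul {t : ℕ} {w : ℕ → ℤ × ℤ} {i j : ℕ} {x y a : ℝ} (h : InCone t w i j x y)
    (ha : 0 ≤ a) : InCone t w i j (a * x) (a * y) where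
  fst_nonneg := mul_nonneg ha h.1
  snd_nonneg := mul_nonneg ha h.2
  left k hk hi := by linarith [mul_nonneg ha (h.left k hk hi)]
  right k hk hi := by linarith [mul_nonneg ha (h.right k hk hi)]

namespace IsLayout

variable {t : ℕ} {w : ℕ → ℤ × ℤ} {lo len : V → ℕ} {pos : V → ℤ × ℤ}

theorem inCone_vector (h : IsLayout G r t w lo len pos) {i j k : ℕ} (hi : i ≤ k) (hj : k < j)
    (hjt : j ≤ t) : InCone t w i j (w k).1 (w k).2 where
  fst_nonneg := by exact_mod_cast h.fst_nonneg k (by omega)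
  snd_nonneg := by exact_mod_cast h.snd_nonneg k (by omega)
  left l hl hli := by
    rcases (hli.trans hi).eq_or_lt with rfl | hlt
    · linarith [mul_comm ((w l).1 : ℝ) (w l).2]
    · have := h.cross_pos l k hlt (by omega)
      exact_mod_cast this.le
  right l hl hli := by
    rcases (show k ≤ l by omega).eq_or_lt with rfl | hlt
    · linarith [mul_comm ((w k).1 : ℝ) (w k).2]
    · have := h.cross_pos k l hlt hl
      exact_mod_cast this.le

/-- Put `z = (x, y)`, `a = w (j - 1)` and `b = w i'`. Then `(a × b) z = -(b × z) a - (z × a) b`,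
where `a × b > 0` and the other two cross products are nonnegative. As `a` and `b` lie in the closed
quadrant, both coordinates of `z` are at most `0`; they are also at least `0`. -/
theorem eq_zero_of_inCone (h : IsLayout G r t w lo len pos) {i j i' j' : ℕ} (hij : i < j)
    (hji : j ≤ i') (hij' : i' < j') (hjt : j' ≤ t) {x y : ℝ} (h1 : InCone t w i j x y)
    (h2 : InCone t w i' j' x y) : x = 0 ∧ y = 0 := by
  have hc := h.cross_pos (j - 1) i' (by omega) (by omega)
  have hc' : (0 : ℝ) < ((w (j - 1)).1 : ℝ) * (w i').2 - (w (j - 1)).2 * (w i').1 := by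
    exact_mod_cast hc
  have ha := h1.right (j - 1) (by omega) (by omega)
  have hb := h2.left i' (by omega) le_rfl
  have f1 : (0 : ℝ) ≤ (w (j - 1)).1 := by exact_mod_cast h.fst_nonneg _ (by omega)
  have f2 : (0 : ℝ) ≤ (w (j - 1)).2 := by exact_mod_cast h.snd_nonneg _ (by omega)
  have g1 : (0 : ℝ) ≤ (w i').1 := by exact_mod_cast h.fst_nonneg _ (by omega)
  have g2 : (0 : ℝ) ≤ (w i').2 := by exact_mod_cast h.snd_nonneg _ (by omega)
  generalize ((w (j - 1)).1 : ℝ) = a1 at *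
  generalize ((w (j - 1)).2 : ℝ) = a2 at *
  generalize ((w i').1 : ℝ) = b1 at *
  generalize ((w i').2 : ℝ) = b2 at *
  have hx := h1.fst_nonneg
  have hy := h1.snd_nonneg
  have ex : x * (a1 * b2 - a2 * b1) ≤ 0 := by
    have : x * (a1 * b2 - a2 * b1) = -((b1 * y - b2 * x) * a1) - (x * a2 - y * a1) * b1 := by ring
    rw [this]
    nlinarith [mul_nonneg hb f1, mul_nonneg ha g1]
  have ey : y * (a1 * b2 - a2 * b1) ≤ 0 := by
    have : y * (a1 * b2 - a2 * b1) = -((b1 * y - b2 * x) * a2) - (x * a2 - y * a1) * b2 := by ring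
    rw [this]
    nlinarith [mul_nonneg hb f2, mul_nonneg ha g2]
  constructor
  · exact le_antisymm (by by_contra hx'; nlinarith [mul_pos (not_le.1 hx') hc']) hx
  · exact le_antisymm (by by_contra hy'; nlinarith [mul_pos (not_le.1 hy') hc']) hy

theorem nested_desc (h : IsLayout G r t w lo len pos) {v u : V} (hd : Desc G r v u) :
    lo v ≤ lo u ∧ lo u + len u ≤ lo v + len v := by
  induction hd with
  | refl => simp
  | tail _ hx ih =>
    have := h.nested _ _ hx
    omega

theorem inCone_desc (h : IsLayout G r t w lo len pos) {v u : V} (hd : Desc G r v u) :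
    InCone t w (lo v) (lo v + len v) ((pos u).1 - (pos v).1) ((pos u).2 - (pos v).2) := by
  induction hd with
  | refl => simpa using InCone.zero t w _ _
  | @tail u x hu hx ih =>
    have h1 := h.nested_desc (hu.tail hx)
    have h2 := h.inCone_vector (i := lo v) (j := lo v + len v) (k := lo x) h1.1
      (by have := h.len_pos x; omega) (h.le_total v)
    have h3 := ih.add h2
    rw [h.pos_child _ _ hx]
    convert h3 using 1 <;> · simp only [Prod.fst_add, Prod.snd_add]; push_cast; ring

/-- The coordinate sum serves as a height that grows along every path from the root. It separates
edges lying on a common root path, where the cones say nothing. -/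
theorem sum_lt_of_isChild (h : IsLayout G r t w lo len pos) {p c : V} (hc : IsChild G r p c) :
    (pos p).1 + (pos p).2 < (pos c).1 + (pos c).2 := by
  have := h.add_pos (lo c) (by have := h.le_total c; have := h.len_pos c; omega)
  rw [h.pos_child _ _ hc]
  simp only [Prod.fst_add, Prod.snd_add]
  linarith

theorem sum_le_of_desc (h : IsLayout G r t w lo len pos) {v u : V} (hd : Desc G r v u) :
    (pos v).1 + (pos v).2 ≤ (pos u).1 + (pos u).2 := by
  induction hd with
  | refl => exact le_rfl
  | tail _ hx ih => exact ih.trans (h.sum_lt_of_isChild hx).le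

theorem eq_of_desc_of_sum_le (h : IsLayout G r t w lo len pos) {v u : V} (hd : Desc G r v u)
    (hs : (pos u).1 + (pos u).2 ≤ (pos v).1 + (pos v).2) : u = v := by
  rcases hd.cases_tail with h1 | ⟨x, h1, h2⟩
  · exact h1
  · have := h.sum_le_of_desc h1
    have := h.sum_lt_of_isChild h2
    omega

@[simp] theorem _root_.Drawing.toPlane_zero (p : ℤ × ℤ) : toPlane p 0 = (p.1 : ℝ) := by
  simp [toPlane]

@[simp] theorem _root_.Drawing.toPlane_one (p : ℤ × ℤ) : toPlane p 1 = (p.2 : ℝ) := by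
  simp [toPlane]

theorem _root_.Drawing.toPlane_ext {x : EuclideanSpace ℝ (Fin 2)} {p : ℤ × ℤ}
    (h0 : x 0 = p.1) (h1 : x 1 = p.2) : x = toPlane p := by
  ext i
  fin_cases i
  · simpa using h0
  · simpa using h1

theorem _root_.Drawing.exists_of_mem_segment {x : EuclideanSpace ℝ (Fin 2)} {p q : ℤ × ℤ}
    (hx : x ∈ segment ℝ (toPlane p) (toPlane q)) : ∃ s : ℝ, 0 ≤ s ∧ s ≤ 1 ∧
      x 0 = p.1 + s * (q.1 - p.1) ∧ x 1 = p.2 + s * (q.2 - p.2) := by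
  obtain ⟨a, b, ha, hb, hab, rfl⟩ := hx
  refine ⟨b, hb, by linarith, ?_, ?_⟩
  · simp only [PiLp.add_apply, PiLp.smul_apply, toPlane_zero, smul_eq_mul]
    rw [show a = 1 - b by linarith]
    ring
  · simp only [PiLp.add_apply, PiLp.smul_apply, toPlane_one, smul_eq_mul]
    rw [show a = 1 - b by linarith]
    ring

/-- The apex is `q` rather than `e`, so that the edge from `q` to `e` itself is included; this is
the case `e = c`, in which `p = q`. -/
theorem inCone_of_mem_segment (h : IsLayout G r t w lo len pos) (hG : G.IsTree) {q e p c : V}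
    (he : IsChild G r q e) (hd : Desc G r e c) (hc : IsChild G r p c)
    {x : EuclideanSpace ℝ (Fin 2)} (hx : x ∈ segment ℝ (toPlane (pos p)) (toPlane (pos c))) :
    InCone t w (lo e) (lo e + len e) (x 0 - (pos q).1) (x 1 - (pos q).2) := by
  obtain ⟨s, hs0, hs1, h0, h1⟩ := exists_of_mem_segment hx
  have hp : InCone t w (lo e) (lo e + len e) ((pos p).1 - (pos q).1) ((pos p).2 - (pos q).2) := by
    rcases hd.of_isChild hG hc with rfl | hep
    · rw [hc.parent_unique hG he]
      simpa using InCone.zero t w _ _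
    · have h1 := h.inCone_vector (i := lo e) (j := lo e + len e) (k := lo e) le_rfl
        (by have := h.len_pos e; omega) (h.le_total e)
      have h2 := (h.inCone_desc hep).add h1
      convert h2 using 1 <;>
      · rw [h.pos_child _ _ he]
        simp only [Prod.fst_add, Prod.snd_add]
        push_cast
        ring
  have hn := h.nested_desc hd
  have h2 := (h.inCone_vector (i := lo e) (j := lo e + len e) (k := lo c) hn.1
        (by have := h.len_pos c; omega) (h.le_total e)).smul hs0
  have h3 := hp.add h2
  rw [h0, h1]
  convert h3 using 1 <;>
  · rw [h.pos_child _ _ hc]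
    simp only [Prod.fst_add, Prod.snd_add]
    push_cast
    ring

/-- On the upper edge the coordinate sum is at most that of `c`, on the lower one at least that of
`p'`, a vertex in the subtree of `c`. A common point forces equality throughout. -/
theorem exists_of_desc (h : IsLayout G r t w lo len pos) (hG : G.IsTree) {p c p' c' : V}
    (hc : IsChild G r p c) (hc' : IsChild G r p' c') (hne : c ≠ c') (hd : Desc G r c c')
    {x : EuclideanSpace ℝ (Fin 2)} (hx : x ∈ segment ℝ (toPlane (pos p)) (toPlane (pos c)))
    (hx' : x ∈ segment ℝ (toPlane (pos p')) (toPlane (pos c'))) :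
    c = p' ∧ x = toPlane (pos c) := by
  have hp' := (hd.of_isChild hG hc').resolve_left hne
  obtain ⟨s, hs0, hs1, h0, h1⟩ := exists_of_mem_segment hx
  obtain ⟨s', hs0', hs1', h0', h1'⟩ := exists_of_mem_segment hx'
  have e1 : (((pos p).1 : ℝ) + (pos p).2) < (pos c).1 + (pos c).2 := by
    exact_mod_cast h.sum_lt_of_isChild hc
  have e2 : (((pos p').1 : ℝ) + (pos p').2) < (pos c').1 + (pos c').2 := by
    exact_mod_cast h.sum_lt_of_isChild hc'
  have e3 : (((pos c).1 : ℝ) + (pos c).2) ≤ (pos p').1 + (pos p').2 := by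
    exact_mod_cast h.sum_le_of_desc hp'
  have e4 : (((pos p').1 : ℝ) + (pos p').2) ≤ x 0 + x 1 := by rw [h0', h1']; nlinarith
  have hs : s = 1 := by
    apply le_antisymm hs1
    by_contra hs
    rw [h0, h1] at e4
    nlinarith [mul_pos (sub_pos.2 (not_le.1 hs)) (sub_pos.2 e1)]
  subst hs
  have hxc : x = toPlane (pos c) := toPlane_ext (by rw [h0]; ring) (by rw [h1]; ring)
  refine ⟨(h.eq_of_desc_of_sum_le hp' ?_).symm, hxc⟩
  rw [hxc] at e4
  simp only [toPlane_zero, toPlane_one] at e4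
  exact_mod_cast e4

theorem eq_of_mem_segment_top (h : IsLayout G r t w lo len pos) {q p c : V}
    (hd : Desc G r q p) (hc : IsChild G r p c)
    (hx : toPlane (pos q) ∈ segment ℝ (toPlane (pos p)) (toPlane (pos c))) : p = q := by
  obtain ⟨s, hs0, hs1, h0, h1⟩ := exists_of_mem_segment hx
  have e1 : (((pos p).1 : ℝ) + (pos p).2) < (pos c).1 + (pos c).2 := by
    exact_mod_cast h.sum_lt_of_isChild hc
  apply h.eq_of_desc_of_sum_le hd
  simp only [toPlane_zero, toPlane_one] at h0 h1
  have : (((pos p).1 : ℝ) + (pos p).2) ≤ (pos q).1 + (pos q).2 := by rw [h0, h1]; nlinarith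
  exact_mod_cast this

/-- If neither lower endpoint descends from the other, the edges lie in the cones of two different
children of some `q`, and can meet only in the apex. Since `q` is an ancestor of both upper
endpoints, the height forces it to be the upper endpoint of both. -/
theorem edge_edge (h : IsLayout G r t w lo len pos) (hG : G.IsTree) {p c p' c' : V}
    (hc : IsChild G r p c) (hc' : IsChild G r p' c') (hne : c ≠ c')
    {x : EuclideanSpace ℝ (Fin 2)} (hx : x ∈ segment ℝ (toPlane (pos p)) (toPlane (pos c)))
    (hx' : x ∈ segment ℝ (toPlane (pos p')) (toPlane (pos c'))) :
    ∃ z, (z = p ∨ z = c) ∧ (z = p' ∨ z = c') ∧ x = toPlane (pos z) := by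
  rcases desc_trichotomy (r := r) hG c c' with hd | hd | ⟨q, e, e', he, he', hee, hd, hd'⟩
  · obtain ⟨h1, h2⟩ := h.exists_of_desc hG hc hc' hne hd hx hx'
    exact ⟨c, Or.inr rfl, Or.inl h1, h2⟩
  · obtain ⟨h1, h2⟩ := h.exists_of_desc hG hc' hc hne.symm hd hx' hx
    exact ⟨c', Or.inl h1, Or.inr rfl, h2⟩
  · have k1 := h.inCone_of_mem_segment hG he hd hc hx
    have k2 := h.inCone_of_mem_segment hG he' hd' hc' hx'
    have l1 := h.len_pos e
    have l2 := h.len_pos e'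
    have hz : x 0 - (pos q).1 = 0 ∧ x 1 - (pos q).2 = 0 := by
      rcases h.disjoint q e e' he he' hee with hj | hj
      · exact h.eq_zero_of_inCone (by omega) hj (by omega) (h.le_total e') k1 k2
      · exact h.eq_zero_of_inCone (by omega) hj (by omega) (h.le_total e) k2 k1
    have hxq : x = toPlane (pos q) := toPlane_ext (by linarith [hz.1]) (by linarith [hz.2])
    have top : ∀ {e p c : V}, IsChild G r q e → Desc G r e c → IsChild G r p c →
        x ∈ segment ℝ (toPlane (pos p)) (toPlane (pos c)) → q = p := by
      intro e p c he hd hc hx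
      refine (h.eq_of_mem_segment_top ?_ hc (hxq ▸ hx)).symm
      rcases hd.of_isChild hG hc with rfl | hep
      · rw [hc.parent_unique hG he]
      · exact .head he hep
    exact ⟨q, Or.inl (top he hd hc hx), Or.inl (top he' hd' hc' hx'), hxq⟩

/-- If two vertices other than the root coincide, the edges from their parents meet there, so by
`edge_edge` they have a common endpoint at that point; by the height it is the lower endpoint of
both. -/
theorem injective (h : IsLayout G r t w lo len pos) (hG : G.IsTree) :
    Function.Injective fun v => toPlane (pos v) := by
  have hroot : ∀ v, toPlane (pos r) = toPlane (pos v) → v = r := by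
    intro v hv
    apply h.eq_of_desc_of_sum_le (desc_root hG v)
    have h0 := congrArg (fun x : EuclideanSpace ℝ (Fin 2) => x 0) hv
    have h1 := congrArg (fun x : EuclideanSpace ℝ (Fin 2) => x 1) hv
    simp only [toPlane_zero, toPlane_one, Int.cast_inj] at h0 h1
    omega
  intro u v huv
  simp only at huv
  by_contra hne
  by_cases hu : u = r
  · subst hu
    exact hne (hroot v huv).symm
  by_cases hv : v = r
  · subst hv
    exact hne (hroot u huv.symm)
  obtain ⟨p, hp⟩ := exists_isChild hG hu
  obtain ⟨q, hq⟩ := exists_isChild hG hv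
  obtain ⟨z, hz1, hz2, hz⟩ := h.edge_edge hG hp hq hne (right_mem_segment ℝ _ _)
    (huv ▸ right_mem_segment ℝ _ _)
  have key : ∀ {p u : V}, IsChild G r p u → (z = p ∨ z = u) → toPlane (pos u) = toPlane (pos z) →
      z = u := by
    intro p u hp hz hpos
    refine hz.resolve_left ?_
    rintro rfl
    have := h.sum_lt_of_isChild hp
    have h0 := congrArg (fun x : EuclideanSpace ℝ (Fin 2) => x 0) hpos
    have h1 := congrArg (fun x : EuclideanSpace ℝ (Fin 2) => x 1) hpos
    simp only [toPlane_zero, toPlane_one, Int.cast_inj] at h0 h1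
    omega
  exact hne ((key hp hz1 hz).symm.trans (key hq hz2 (huv ▸ hz)))

theorem edge_edge_adj (h : IsLayout G r t w lo len pos) (hG : G.IsTree) {u v u' v' : V}
    (hadj : G.Adj u v) (hadj' : G.Adj u' v') (hne : s(u, v) ≠ s(u', v'))
    {x : EuclideanSpace ℝ (Fin 2)} (hx : x ∈ segment ℝ (toPlane (pos u)) (toPlane (pos v)))
    (hx' : x ∈ segment ℝ (toPlane (pos u')) (toPlane (pos v'))) :
    ∃ z, (z = u ∨ z = v) ∧ (z = u' ∨ z = v') ∧ x = toPlane (pos z) := by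
  wlog huv : IsChild G r u v generalizing u v
  · obtain ⟨z, h1, h2⟩ := this hadj.symm (by rwa [Sym2.eq_swap]) (by rwa [segment_symm])
      ((isChild_or_isChild hG hadj).resolve_left huv)
    exact ⟨z, h1.symm, h2⟩
  wlog huv' : IsChild G r u' v' generalizing u' v'
  · obtain ⟨z, h1, h2, h3⟩ := this hadj'.symm (by rwa [segment_symm])
      (by rwa [Sym2.eq_swap (a := v')]) ((isChild_or_isChild hG hadj').resolve_left huv')
    exact ⟨z, h1, h2.symm, h3⟩
  refine h.edge_edge hG huv huv' ?_ hx hx'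
  rintro rfl
  exact hne (by rw [huv.parent_unique hG huv'])

theorem isFary (h : IsLayout G r t w lo len pos) (hG : G.IsTree) :
    IsFary G fun v => toPlane (pos v) where
  injective := h.injective hG
  vertex_edge := by
    intro u v x hadj hx
    by_cases hx1 : x = r
    · subst hx1
      have key : ∀ {u v : V}, IsChild G x u v →
          toPlane (pos x) ∈ segment ℝ (toPlane (pos u)) (toPlane (pos v)) → x = u :=
        fun huv hx => (h.eq_of_mem_segment_top (desc_root hG _) huv hx).symm
      rcases isChild_or_isChild (r := x) hG hadj with huv | huv
      · exact Or.inl (key huv hx)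
      · exact Or.inr (key huv (by rwa [segment_symm]))
    -- A vertex on an edge is a point where the edge from its parent meets that edge, so the claim
    -- reduces to the statement about two edges.
    · obtain ⟨p, hp⟩ := exists_isChild hG hx1
      by_cases hs : s(p, x) = s(u, v)
      · have : x ∈ s(u, v) := hs ▸ Sym2.mem_mk_right p x
        simpa using this
      · obtain ⟨z, -, h2, h3⟩ := h.edge_edge_adj hG hp.1 hadj hs (right_mem_segment ℝ _ _) hx
        rw [h.injective hG h3]
        exact h2
  edge_edge := by
    intro u v u' v' hadj hadj' hne x hx
    exact h.edge_edge_adj hG hadj hadj' hne hx.1 hx.2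

end IsLayout

end Drawing

/-! ### The layout given by a preorder traversal -/

namespace RootedTree

variable {V : Type u} {G : SimpleGraph V} {r : V}

/-- `ch v` lists the children of `v`, each once. -/
def IsChildLists (G : SimpleGraph V) (r : V) (ch : V → List V) : Prop :=
  ∀ v, (ch v).Nodup ∧ ∀ w, w ∈ ch v ↔ IsChild G r v w

theorem exists_isChildLists [Fintype V] (G : SimpleGraph V) (r : V) :
    ∃ ch, IsChildLists G r ch := by
  classical
  exact ⟨fun v => (Finset.univ.filter fun w => IsChild G r v w).toList, fun v =>
    ⟨Finset.nodup_toList _, fun w => by simp⟩⟩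

theorem dist_lt_card [Fintype V] (hG : G.IsTree) (v : V) : G.dist r v < Fintype.card V := by
  obtain ⟨P, hP, hPl⟩ := hG.connected.exists_path_of_dist r v
  rw [← hPl]
  exact hP.length_lt

open Classical in
/-- The parent of a vertex; the root is its own parent. -/
noncomputable def parent (G : SimpleGraph V) (r c : V) : V :=
  if h : ∃ p, IsChild G r p c then h.choose else c

theorem parent_eq (hG : G.IsTree) {p c : V} (h : IsChild G r p c) : parent G r c = p := by
  have h' : ∃ p, IsChild G r p c := ⟨p, h⟩
  rw [parent, dif_pos h']
  exact h'.choose_spec.parent_unique hG h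

theorem parent_root : parent G r r = r :=
  dif_neg fun ⟨p, h⟩ => not_isChild_root p h

theorem isChild_parent (hG : G.IsTree) {c : V} (hc : c ≠ r) : IsChild G r (parent G r c) c := by
  obtain ⟨p, hp⟩ := exists_isChild hG hc
  rwa [parent_eq hG hp]

theorem isChild_iff_adj_and_ne (hG : G.IsTree) {v w : V} :
    IsChild G r v w ↔ G.Adj v w ∧ w ≠ parent G r v := by
  constructor
  · intro h
    refine ⟨h.1, ?_⟩
    rintro rfl
    by_cases hv : v = r
    · subst hv
      exact not_isChild_root _ (by rwa [parent_root] at h)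
    · have h1 := (isChild_parent hG hv).2
      have h2 := h.2
      omega
  · rintro ⟨h1, h2⟩
    refine (isChild_or_isChild hG h1).resolve_right fun h => h2 (parent_eq hG h).symm

/-! ### Counting the leaves and numbering them in preorder -/

/-- The number of leaves at depth at most `k - 1` below `v`. -/
def leavesAux (ch : V → List V) : ℕ → V → ℕ
  | 0, _ => 0
  | k + 1, v => if (ch v).isEmpty then 1 else ((ch v).map (leavesAux ch k)).sum

/-- The number of leaves in the subtree of `v`. -/
noncomputable def leaves [Fintype V] (G : SimpleGraph V) (r : V) (ch : V → List V) (v : V) : ℕ :=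
  leavesAux ch (Fintype.card V - G.dist r v) v

/-- The fuel `card V - dist r v` drops by exactly one from a vertex to its child and is always
positive, so the bounded recursion never runs out. -/
theorem leaves_eq [Fintype V] (hG : G.IsTree) {ch : V → List V} (hch : IsChildLists G r ch)
    (v : V) : leaves G r ch v = if (ch v).isEmpty then 1 else ((ch v).map (leaves G r ch)).sum := by
  have hd := dist_lt_card (r := r) hG v
  obtain ⟨k, hk⟩ : ∃ k, Fintype.card V - G.dist r v = k + 1 := ⟨_, (Nat.succ_pred (by omega)).symm⟩
  rw [leaves, hk, leavesAux]
  congr 2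
  refine List.map_congr_left fun w hw => ?_
  have := (((hch v).2 w).1 hw).2
  rw [leaves, show Fintype.card V - G.dist r w = k by omega]

theorem leaves_pos [Fintype V] (hG : G.IsTree) {ch : V → List V} (hch : IsChildLists G r ch)
    (v : V) : 0 < leaves G r ch v := by
  induction h : Fintype.card V - G.dist r v using Nat.strong_induction_on generalizing v with
  | _ k ih =>
    rw [leaves_eq hG hch]
    split_ifs with he
    · exact one_pos
    · cases hl : ch v with
      | nil => simp [hl] at he
      | cons w l =>
        have hw := (((hch v).2 w).1 (by simp [hl]))
        have := dist_lt_card (r := r) hG w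
        have := ih _ (by have := hw.2; omega) w rfl
        simp only [List.map_cons, List.sum_cons]
        omega

theorem isEmpty_iff_isLeaf {ch : V → List V} (hch : IsChildLists G r ch) (v : V) :
    (ch v).isEmpty ↔ IsLeaf G r v := by
  rw [List.isEmpty_iff, List.eq_nil_iff_forall_not_mem]
  simp only [(hch v).2, IsLeaf]

/-- Sum the recursion over all vertices. Every vertex except the root is a child of exactly one
vertex, so all values cancel except the one at the root and the number of leaves. -/
theorem leaves_root [Fintype V] (hG : G.IsTree) {ch : V → List V} (hch : IsChildLists G r ch) :
    leaves G r ch r = leafCount G r := by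
  classical
  have h1 : ∑ v, leaves G r ch v = leafCount G r + ∑ v, ((ch v).map (leaves G r ch)).sum := by
    rw [leafCount, Set.ncard_eq_toFinset_card', Finset.card_eq_sum_ones]
    have : ∑ v ∈ {v | IsLeaf G r v}.toFinset, 1
        = ∑ v, if (ch v).isEmpty then 1 else 0 := by
      rw [Finset.sum_ite, Finset.sum_const_zero, add_zero]
      apply Finset.sum_congr _ fun _ _ => rfl
      ext v
      simp only [Set.mem_toFinset, Set.mem_ofPred_eq, Finset.mem_filter, Finset.mem_univ, true_and]
      exact (isEmpty_iff_isLeaf hch v).symm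
    rw [this, ← Finset.sum_add_distrib]
    refine Finset.sum_congr rfl fun v _ => ?_
    rw [leaves_eq hG hch]
    split_ifs with he
    · simp [List.isEmpty_iff.1 he]
    · simp
  have h2 : ∑ v, ((ch v).map (leaves G r ch)).sum
      = ∑ v ∈ Finset.univ.erase r, leaves G r ch v := by
    have : ∀ v, ((ch v).map (leaves G r ch)).sum
        = ∑ w ∈ (Finset.univ.erase r).filter (fun w => parent G r w = v), leaves G r ch w := by
      intro v
      rw [← List.sum_toFinset _ (hch v).1]
      apply Finset.sum_congr _ fun _ _ => rfl
      ext w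
      simp only [List.mem_toFinset, (hch v).2, Finset.mem_filter, Finset.mem_erase,
        Finset.mem_univ, and_true]
      constructor
      · intro h
        refine ⟨?_, parent_eq hG h⟩
        rintro rfl
        exact not_isChild_root _ h
      · rintro ⟨h, rfl⟩
        exact isChild_parent hG h
    simp only [this]
    exact Finset.sum_fiberwise _ _ _
  rw [h2, ← Finset.add_sum_erase _ _ (Finset.mem_univ r)] at h1
  omega

open Classical in
/-- The number of leaves in the subtrees of the siblings listed before `c`. -/
noncomputable def leavesBefore [Fintype V] (G : SimpleGraph V) (r : V) (ch : V → List V) (c : V) :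
    ℕ :=
  (((ch (parent G r c)).takeWhile fun w => w ≠ c).map (leaves G r ch)).sum

/-- Sums along the path from the root, at distance `k`, to a vertex. -/
noncomputable def pathSum {M : Type*} [Add M] (G : SimpleGraph V) (r : V) (a : M) (f : V → M) :
    ℕ → V → M
  | 0, _ => a
  | k + 1, v => pathSum G r a f k (parent G r v) + f v

/-- The number of leaves that a preorder traversal meets before `v`. -/
noncomputable def firstLeaf [Fintype V] (G : SimpleGraph V) (r : V) (ch : V → List V) (v : V) : ℕ :=
  pathSum G r 0 (leavesBefore G r ch) (G.dist r v) v

/-- The position of `v` if the edge from its parent is drawn as the vector `w (firstLeaf v)`. -/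
noncomputable def position [Fintype V] (G : SimpleGraph V) (r : V) (ch : V → List V)
    (w : ℕ → ℕ × ℕ) (v : V) : ℕ × ℕ :=
  pathSum G r (w 0) (fun v => w (firstLeaf G r ch v)) (G.dist r v) v

theorem pathSum_root {M : Type*} [Add M] (a : M) (f : V → M) :
    pathSum G r a f (G.dist r r) r = a := by simp [pathSum]

theorem pathSum_child {M : Type*} [Add M] (hG : G.IsTree) (a : M) (f : V → M) {p c : V}
    (h : IsChild G r p c) : pathSum G r a f (G.dist r c) c
      = pathSum G r a f (G.dist r p) p + f c := by
  rw [h.2, pathSum, parent_eq hG h]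

theorem takeWhile_append_ne {α : Type*} [DecidableEq α] {l₁ l₂ : List α} {c : α} (h : c ∉ l₁) :
    (l₁ ++ c :: l₂).takeWhile (fun w => decide (w ≠ c)) = l₁ := by
  induction l₁ with
  | nil => simp
  | cons a l ih =>
    rw [List.mem_cons, not_or] at h
    rw [List.cons_append, List.takeWhile_cons, if_pos (by simpa using Ne.symm h.1), ih h.2]

theorem firstLeaf_child [Fintype V] (hG : G.IsTree) {ch : V → List V} (hch : IsChildLists G r ch)
    {p c : V} {l₁ l₂ : List V} (h : ch p = l₁ ++ c :: l₂) :
    firstLeaf G r ch c = firstLeaf G r ch p + (l₁.map (leaves G r ch)).sum := by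
  have hc : IsChild G r p c := ((hch p).2 c).1 (by simp [h])
  rw [firstLeaf, pathSum_child hG _ _ hc, leavesBefore, parent_eq hG hc]
  congr 3
  have hn := (hch p).1
  rw [h] at hn ⊢
  have hc' : c ∉ l₁ := fun hm => (List.nodup_append.1 hn).2.2 _ hm _ (by simp) rfl
  classical
  exact takeWhile_append_ne hc'

theorem firstLeaf_root [Fintype V] (ch : V → List V) : firstLeaf G r ch r = 0 :=
  pathSum_root _ _

/-- The root sits at `w 0` and not at the origin, because the machine treats it like any other
vertex: its parent is itself, with stored coordinates `0`. The grid is measured from the root, so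
the shift is harmless. -/
theorem position_root [Fintype V] (ch : V → List V) (w : ℕ → ℕ × ℕ) :
    position G r ch w r = w 0 := pathSum_root _ _

theorem position_child [Fintype V] (hG : G.IsTree) (ch : V → List V) (w : ℕ → ℕ × ℕ) {p c : V}
    (h : IsChild G r p c) :
    position G r ch w c = position G r ch w p + w (firstLeaf G r ch c) := pathSum_child hG _ _ h

theorem position_le [Fintype V] (hG : G.IsTree) (ch : V → List V) (w : ℕ → ℕ × ℕ) {M : ℕ}
    (hw : ∀ k, (w k).1 ≤ M ∧ (w k).2 ≤ M) (v : V) :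
    (position G r ch w v).1 ≤ (G.dist r v + 1) * M ∧
      (position G r ch w v).2 ≤ (G.dist r v + 1) * M := by
  induction desc_root (r := r) hG v with
  | refl => simpa [position_root] using hw 0
  | @tail p c _ hc ih =>
    rw [position_child hG ch w hc, hc.2]
    have := hw (firstLeaf G r ch c)
    simp only [Prod.fst_add, Prod.snd_add]
    constructor <;> linarith

theorem firstLeaf_nested [Fintype V] (hG : G.IsTree) {ch : V → List V}
    (hch : IsChildLists G r ch) {p c : V} (hc : IsChild G r p c) :
    firstLeaf G r ch p ≤ firstLeaf G r ch c ∧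
      firstLeaf G r ch c + leaves G r ch c ≤ firstLeaf G r ch p + leaves G r ch p := by
  obtain ⟨l₁, l₂, hl⟩ := List.append_of_mem (((hch p).2 c).2 hc)
  rw [firstLeaf_child hG hch hl, leaves_eq hG hch p, hl]
  simp
  omega

theorem firstLeaf_disjoint [Fintype V] (hG : G.IsTree) {ch : V → List V}
    (hch : IsChildLists G r ch) {p c c' : V} (hc : IsChild G r p c) (hc' : IsChild G r p c')
    (hne : c ≠ c') :
    firstLeaf G r ch c + leaves G r ch c ≤ firstLeaf G r ch c' ∨
      firstLeaf G r ch c' + leaves G r ch c' ≤ firstLeaf G r ch c := by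
  obtain ⟨l₁, l₂, hl⟩ := List.append_of_mem (((hch p).2 c).2 hc)
  have hm := ((hch p).2 c').2 hc'
  rw [hl, List.mem_append, List.mem_cons] at hm
  rcases hm with hm | hm | hm
  · obtain ⟨m₁, m₂, rfl⟩ := List.append_of_mem hm
    right
    rw [firstLeaf_child hG hch hl, firstLeaf_child hG hch (l₁ := m₁) (c := c') (p := p)
      (l₂ := m₂ ++ c :: l₂) (by simpa using hl)]
    simp
    omega
  · exact absurd hm.symm hne
  · obtain ⟨m₁, m₂, rfl⟩ := List.append_of_mem hm
    left
    rw [firstLeaf_child hG hch hl, firstLeaf_child hG hch (l₁ := l₁ ++ c :: m₁) (c := c') (p := p)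
      (l₂ := m₂) (by simpa using hl)]
    simp
    omega

theorem firstLeaf_add_leaves_le [Fintype V] (hG : G.IsTree) {ch : V → List V}
    (hch : IsChildLists G r ch) (v : V) :
    firstLeaf G r ch v + leaves G r ch v ≤ leafCount G r := by
  rw [← leaves_root hG hch]
  induction desc_root (r := r) hG v with
  | refl => simp [firstLeaf_root]
  | tail _ hc ih => exact (firstLeaf_nested hG hch hc).2.trans ih

end RootedTree

/-! ### The drawing with Pythagorean vectors: edge lengths and grid size -/

namespace Drawing

open RootedTree Fractions

variable {V : Type u} {G : SimpleGraph V} {r : V}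

/-- The Pythagorean vector of the `k`-th admissible fraction. -/
def vec (N k : ℕ) : ℕ × ℕ :=
  ((enum N k).1 * (enum N k).1 - (enum N k).2 * (enum N k).2,
    2 * ((enum N k).1 * (enum N k).2))

theorem vec_le (N k : ℕ) :
    (vec N k).1 ≤ 2 * (N + 1) ^ 2 ∧ (vec N k).2 ≤ 2 * (N + 1) ^ 2 := by
  obtain ⟨h1, h2⟩ := enum_bounds N k
  have := Nat.mul_le_mul h1 h1
  have := Nat.mul_le_mul h1 h2
  simp only [vec, sq]
  omega

/-- The number of leaves, scaled to the bound for the coordinates of the vectors. -/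
noncomputable def coordBound (G : SimpleGraph V) (r : V) : ℕ := 13 * leafCount G r / 2

/-- The positions of the vertices in the drawing. -/
noncomputable def gridPos [Fintype V] (G : SimpleGraph V) (r : V) (ch : V → List V) (v : V) :
    ℤ × ℤ :=
  let p := position G r ch (vec (coordBound G r)) v
  ((p.1 : ℤ), (p.2 : ℤ))

theorem leafCount_pos [Fintype V] (hG : G.IsTree) : 0 < leafCount G r := by
  obtain ⟨ch, hch⟩ := exists_isChildLists G r
  rw [← leaves_root hG hch]
  exact leaves_pos hG hch r

theorem one_lt_coordBound [Fintype V] (hG : G.IsTree) : 1 < coordBound G r := by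
  have := leafCount_pos (r := r) hG
  simp only [coordBound]
  omega

theorem enum_coordBound_admissible [Fintype V] (hG : G.IsTree) {k : ℕ} (hk : k < leafCount G r) :
    Admissible (coordBound G r) (enum (coordBound G r) k).1 (enum (coordBound G r) k).2 :=
  enum_admissible (one_lt_coordBound hG) (le_card_values (leafCount_pos hG)) hk

theorem isLayout_gridPos [Fintype V] (hG : G.IsTree) {ch : V → List V}
    (hch : IsChildLists G r ch) :
    IsLayout G r (leafCount G r)
      (fun k => (((vec (coordBound G r) k).1 : ℤ), ((vec (coordBound G r) k).2 : ℤ)))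
      (firstLeaf G r ch) (leaves G r ch) (gridPos G r ch) where
  fst_nonneg k _ := by positivity
  snd_nonneg k _ := by positivity
  add_pos k hk := by
    have h := enum_coordBound_admissible hG hk
    have h0 := h.pos
    have h1 := h.le
    simp only [vec]
    rcases Nat.eq_zero_or_pos (enum (coordBound G r) k).2 with h2 | h2
    · have := Nat.mul_pos h0 h0
      simp only [h2, mul_zero, Nat.sub_zero, Nat.cast_zero, add_zero]
      exact_mod_cast this
    · have := Nat.mul_pos h0 h2
      have : (0 : ℤ) < ((2 * ((enum (coordBound G r) k).1 * (enum (coordBound G r) k).2) : ℕ) : ℤ) := by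
        exact_mod_cast (by omega)
      positivity
  cross_pos i j hij hj := by
    have hi := enum_coordBound_admissible hG (hij.trans hj)
    have hj' := enum_coordBound_admissible hG hj
    have hlt := enum_lt (one_lt_coordBound hG) (le_card_values (leafCount_pos hG)) hij hj
    have p1 := hi.pos
    have p2 := hj'.pos
    rw [div_lt_div_iff₀ (by exact_mod_cast p1) (by exact_mod_cast p2)] at hlt
    have s1 := Nat.mul_le_mul hi.le hi.le
    have s2 := Nat.mul_le_mul hj'.le hj'.le
    simp only [vec]
    generalize (enum (coordBound G r) i).1 = a at *
    generalize (enum (coordBound G r) i).2 = b at *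
    generalize (enum (coordBound G r) j).1 = c at *
    generalize (enum (coordBound G r) j).2 = d at *
    push_cast [Nat.cast_sub s1, Nat.cast_sub s2]
    have hlt' : (b * c : ℤ) < d * a := by exact_mod_cast hlt
    have hac : (0 : ℤ) < a * c := by positivity
    have hbd : (0 : ℤ) ≤ b * d := by positivity
    -- Squaring complex numbers doubles angles: the cross product of the squares of `a + bi` and `c
    -- + di` is twice the dot product times the cross product of `(a, b)` and `(c, d)`.
    have : ((a : ℤ) * a - b * b) * (2 * (c * d)) - 2 * (a * b) * (c * c - d * d)
        = 2 * (a * c + b * d) * (d * a - b * c) := by ring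
    rw [this]
    have : (0 : ℤ) < d * a - b * c := by linarith
    positivity
  pos_child p c hc := by
    simp [gridPos, position_child hG ch _ hc]
  len_pos v := leaves_pos hG hch v
  le_total v := firstLeaf_add_leaves_le hG hch v
  nested p c hc := firstLeaf_nested hG hch hc
  disjoint p c c' hc hc' hne := firstLeaf_disjoint hG hch hc hc' hne

theorem firstLeaf_lt [Fintype V] (hG : G.IsTree) {ch : V → List V}
    (hch : IsChildLists G r ch) (v : V) : firstLeaf G r ch v < leafCount G r := by
  have := firstLeaf_add_leaves_le hG hch v
  have := leaves_pos hG hch v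
  omega

theorem dist_toPlane (p q : ℤ × ℤ) :
    dist (toPlane p) (toPlane q) = Real.sqrt (((p.1 : ℝ) - q.1) ^ 2 + ((p.2 : ℝ) - q.2) ^ 2) := by
  rw [EuclideanSpace.dist_eq, Fin.sum_univ_two]
  simp [Real.dist_eq, sq_abs]

theorem isTrulyIntegralFary_gridPos [Fintype V] (hG : G.IsTree) {ch : V → List V}
    (hch : IsChildLists G r ch) : IsTrulyIntegralFary G (gridPos G r ch) where
  fary := (isLayout_gridPos hG hch).isFary hG
  integral := by
    intro u v hadj
    wlog huv : IsChild G r u v generalizing u v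
    · rw [dist_comm]
      exact this hadj.symm ((isChild_or_isChild hG hadj).resolve_left huv)
    have h := enum_coordBound_admissible hG (firstLeaf_lt hG hch v)
    refine ⟨(enum (coordBound G r) (firstLeaf G r ch v)).1 ^ 2
      + (enum (coordBound G r) (firstLeaf G r ch v)).2 ^ 2, ?_⟩
    rw [dist_comm, dist_toPlane, (isLayout_gridPos hG hch).pos_child _ _ huv]
    have s1 := Nat.mul_le_mul h.le h.le
    simp only [vec, Prod.fst_add, Prod.snd_add]
    generalize (enum (coordBound G r) (firstLeaf G r ch v)).1 = a at *
    generalize (enum (coordBound G r) (firstLeaf G r ch v)).2 = b at *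
    push_cast [Nat.cast_sub s1]
    rw [← Real.sqrt_sq (show (0 : ℝ) ≤ a ^ 2 + b ^ 2 by positivity)]
    congr 1
    ring

theorem gridPos_bounds [Fintype V] (hG : G.IsTree) {ch : V → List V}
    (hch : IsChildLists G r ch) (v : V) :
    ((gridPos G r ch r).1 ≤ (gridPos G r ch v).1 ∧
      (gridPos G r ch v).1 ≤ (gridPos G r ch r).1 + G.dist r v * (coordBound G r - 1)) ∧
    ((gridPos G r ch r).2 ≤ (gridPos G r ch v).2 ∧
      (gridPos G r ch v).2 ≤ (gridPos G r ch r).2 + G.dist r v * (coordBound G r - 1)) := by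
  induction desc_root (r := r) hG v with
  | refl => simp
  | @tail p c _ hc ih =>
    rw [(isLayout_gridPos hG hch).pos_child _ _ hc, hc.2]
    have h := enum_coordBound_admissible hG (firstLeaf_lt hG hch c)
    have h1 : (vec (coordBound G r) (firstLeaf G r ch c)).1 + 1 ≤ coordBound G r := by
      have := h.sq_lt
      simp only [vec]
      omega
    have h2 : (vec (coordBound G r) (firstLeaf G r ch c)).2 + 1 ≤ coordBound G r := by
      have := h.mul_lt
      simp only [vec]
      omega
    zify at h1 h2
    simp only [Prod.fst_add, Prod.snd_add]
    push_cast
    obtain ⟨⟨i1, i2⟩, i3, i4⟩ := ih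
    refine ⟨⟨by omega, by linarith⟩, by omega, by linarith⟩

/-- Along `d` edges, each coordinate grows by at most `N - 1` per edge, which spans `d (N - 1) + 1`
grid lines. This is at most `d N` for `d ≥ 1`; for `d = 0` the maximum with `1` takes over. -/
theorem onGrid_gridPos [Fintype V] (hG : G.IsTree) {ch : V → List V}
    (hch : IsChildLists G r ch) :
    OnGrid (gridPos G r ch) (max 1 (2 * Real.pi ^ 2 / 3 * leafCount G r * depth G r))
      (max 1 (2 * Real.pi ^ 2 / 3 * leafCount G r * depth G r)) := by
  have ht := leafCount_pos (r := r) hG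
  have hN : 1 ≤ coordBound G r := (one_lt_coordBound hG).le
  have hle : ((depth G r * (coordBound G r - 1) + 1 : ℕ) : ℝ)
      ≤ max 1 (2 * Real.pi ^ 2 / 3 * leafCount G r * depth G r) := by
    rcases Nat.eq_zero_or_pos (depth G r) with hd | hd
    · simp [hd]
    · apply le_max_of_le_right
      have h1 : depth G r * (coordBound G r - 1) + 1 ≤ depth G r * coordBound G r := by
        obtain ⟨m, hm⟩ : ∃ m, coordBound G r = m + 1 := ⟨_, (Nat.succ_pred (by omega)).symm⟩
        rw [hm, Nat.add_sub_cancel, mul_add]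
        omega
      have h2 : (coordBound G r : ℝ) ≤ 13 * leafCount G r / 2 := by
        have := @Nat.cast_div_le ℝ _ _ _ (13 * leafCount G r) 2
        push_cast at this
        exact this
      have h3 : (13 / 2 : ℝ) ≤ 2 * Real.pi ^ 2 / 3 := by nlinarith [Real.pi_gt_d2]
      calc ((depth G r * (coordBound G r - 1) + 1 : ℕ) : ℝ)
          ≤ depth G r * coordBound G r := by exact_mod_cast h1
        _ ≤ depth G r * (13 * leafCount G r / 2) := by gcongr
        _ = 13 / 2 * leafCount G r * depth G r := by ring
        _ ≤ 2 * Real.pi ^ 2 / 3 * leafCount G r * depth G r := by gcongr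
  refine ⟨_, _, hle, hle, (gridPos G r ch r).1, (gridPos G r ch r).2, fun v => ?_⟩
  obtain ⟨⟨h1, h2⟩, h3, h4⟩ := gridPos_bounds hG hch v
  have hdv : G.dist r v ≤ depth G r :=
    Finset.le_sup (f := fun v => G.dist r v) (Finset.mem_univ v)
  have : (G.dist r v : ℤ) * (coordBound G r - 1) ≤ depth G r * (coordBound G r - 1) := by
    apply mul_le_mul_of_nonneg_right
    · exact_mod_cast hdv
    · have : (1 : ℤ) ≤ coordBound G r := by exact_mod_cast hN
      linarith
  push_cast [Nat.cast_sub hN]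
  refine ⟨⟨h1, by linarith⟩, h3, by linarith⟩

theorem gridSize_le [Fintype V] (hG : G.IsTree) :
    max 1 (2 * Real.pi ^ 2 / 3 * leafCount G r * depth G r)
      ≤ 11 * (Fintype.card V : ℝ) ^ 2 := by
  have hn : 0 < Fintype.card V := Fintype.card_pos_iff.2 ⟨r⟩
  have hn1 : (1 : ℝ) ≤ Fintype.card V := by exact_mod_cast hn
  have ht : (leafCount G r : ℝ) ≤ Fintype.card V := by
    have : leafCount G r ≤ Fintype.card V := by
      rw [← Nat.card_eq_fintype_card]
      exact Set.ncard_le_card _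
    exact_mod_cast this
  have hd : (depth G r : ℝ) ≤ Fintype.card V := by
    have : depth G r ≤ Fintype.card V := Finset.sup_le fun v _ => (dist_lt_card hG v).le
    exact_mod_cast this
  -- `π ≤ 4` already gives `32 / 3`.
  have hpi : 2 * Real.pi ^ 2 / 3 ≤ 11 := by nlinarith [Real.pi_le_four, Real.pi_pos]
  apply max_le
  · nlinarith
  · calc 2 * Real.pi ^ 2 / 3 * leafCount G r * depth G r
        ≤ 11 * Fintype.card V * Fintype.card V := by gcongr
      _ = _ := by ring

end Drawing

/-! ### Verifying programs for the random access machine -/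

namespace RAM

variable {B : ℕ}

/-- Started in `s`, the program `p` halts after at most `T` steps in a state with property `Q`, and
all numbers written on the way are at most `B`. -/
def Run (B : ℕ) (p : Prog) (s : State) (T : ℕ) (Q : State → Prop) : Prop :=
  ∃ s' T', Exec B p s s' T' ∧ T' ≤ T ∧ Q s'

/-- A sequence of programs. -/
def block : List Prog → Prog
  | [] => .skip
  | p :: l => .seq p (block l)

/-- If `R i ≠ R j` then `p`. -/
def ifNe (i j : ℕ) (p : Prog) : Prog := .cond i j p (.cond j i p .skip)

@[simp] theorem State.reg_setReg (s : State) (i x j : ℕ) :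
    (s.setReg i x).reg j = if j = i then x else s.reg j := by
  simp [State.setReg, Function.update_apply]

@[simp] theorem State.mem_setReg (s : State) (i x : ℕ) : (s.setReg i x).mem = s.mem := rfl

@[simp] theorem State.reg_setMem (s : State) (a x : ℕ) : (s.setMem a x).reg = s.reg := rfl

@[simp] theorem State.mem_setMem (s : State) (a x b : ℕ) :
    (s.setMem a x).mem b = if b = a then x else s.mem b := by
  simp [State.setMem, Function.update_apply]

theorem Run.mono {p : Prog} {s : State} {T T' : ℕ} {Q Q' : State → Prop} (h : Run B p s T Q)
    (hT : T ≤ T') (hQ : ∀ s, Q s → Q' s) : Run B p s T' Q' := by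
  obtain ⟨s', T₁, h1, h2, h3⟩ := h
  exact ⟨s', T₁, h1, h2.trans hT, hQ _ h3⟩

theorem Run.skip {s : State} {T : ℕ} {Q : State → Prop} (hT : 1 ≤ T) (h : Q s) :
    Run B .skip s T Q := ⟨s, 1, .skip s, hT, h⟩

/-- The written value `x` is prescribed by the caller. Verifications can thus state the contents of
registers in mathematical terms and bound them by `B` as a separate arithmetic condition. -/
theorem Run.op {s : State} {o : BinOp} {i j k T : ℕ} {Q : State → Prop} (hT : 1 ≤ T) (x : ℕ)
    (hx : o.eval (s.reg j) (s.reg k) = x) (hB : x ≤ B) (h : Q (s.setReg i x)) :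
    Run B (.op o i j k) s T Q := by
  subst hx
  exact ⟨_, 1, .op s o i j k hB, hT, h⟩

theorem Run.nil {s : State} {T : ℕ} {Q : State → Prop} (h : Q s) : Run B (block []) s (T + 1) Q :=
  .skip (by omega) h

theorem Run.cons {p : Prog} {l : List Prog} {s : State} {T : ℕ} (T₁ T₂ : ℕ) {Q : State → Prop}
    (h : Run B p s T₁ fun s' => Run B (block l) s' T₂ Q) (hT : T₁ + T₂ ≤ T) :
    Run B (block (p :: l)) s T Q := by
  obtain ⟨s', T', h1, h2, s'', T'', h3, h4, h5⟩ := h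
  exact ⟨s'', T' + T'', .seq h1 h3, by omega, h5⟩

theorem Run.consConst {l : List Prog} {s : State} {T i k : ℕ} {Q : State → Prop} (hB : k ≤ B)
    (h : Run B (block l) (s.setReg i k) T Q) : Run B (block (.const i k :: l)) s (T + 1) Q :=
  .cons 1 T ⟨_, 1, .const s i k hB, le_rfl, h⟩ (by omega)

theorem Run.consOp {l : List Prog} {s : State} {o : BinOp} {T i j k : ℕ} {Q : State → Prop} (x : ℕ)
    (hx : o.eval (s.reg j) (s.reg k) = x) (hB : x ≤ B)
    (h : Run B (block l) (s.setReg i x) T Q) : Run B (block (.op o i j k :: l)) s (T + 1) Q :=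
  .cons 1 T (.op le_rfl x hx hB h) (by omega)

theorem Run.consLoad {l : List Prog} {s : State} {T i j : ℕ} {Q : State → Prop} (x : ℕ)
    (hx : s.mem (s.reg j) = x) (hB : x ≤ B) (h : Run B (block l) (s.setReg i x) T Q) :
    Run B (block (.load i j :: l)) s (T + 1) Q := by
  subst hx
  exact .cons 1 T ⟨_, 1, .load s i j hB, le_rfl, h⟩ (by omega)

theorem Run.consStore {l : List Prog} {s : State} {T i j : ℕ} {Q : State → Prop} (a x : ℕ)
    (ha : s.reg i = a) (hx : s.reg j = x) (hB : x ≤ B)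
    (h : Run B (block l) (s.setMem a x) T Q) :
    Run B (block (.store i j :: l)) s (T + 1) Q := by
  subst hx ha
  exact .cons 1 T ⟨_, 1, .store s i j hB, le_rfl, h⟩ (by omega)

theorem Run.cond {p q : Prog} {s : State} {i j T : ℕ} {Q : State → Prop}
    (hp : s.reg i < s.reg j → Run B p s T Q) (hq : ¬ s.reg i < s.reg j → Run B q s T Q) :
    Run B (.cond i j p q) s (T + 1) Q := by
  by_cases h : s.reg i < s.reg j
  · obtain ⟨s', T', h1, h2, h3⟩ := hp h
    exact ⟨s', _, .cond_true h h1, by omega, h3⟩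
  · obtain ⟨s', T', h1, h2, h3⟩ := hq h
    exact ⟨s', _, .cond_false h h1, by omega, h3⟩

theorem Run.ifNe {p : Prog} {s : State} {i j T : ℕ} {Q : State → Prop} (hT : 1 ≤ T)
    (hp : s.reg i ≠ s.reg j → Run B p s T Q) (hq : s.reg i = s.reg j → Q s) :
    Run B (ifNe i j p) s (T + 2) Q :=
  .cond (fun h => (hp h.ne).mono (by omega) fun _ => id)
    fun h => .cond (fun h' => hp h'.ne') fun h' => .skip hT (hq (by omega))

/-- A loop with an invariant that mentions the time left. -/
theorem Run.loop {p : Prog} {i j : ℕ} {Q : State → Prop} (I : ℕ → State → Prop)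
    (hstep : ∀ τ s, I τ s → s.reg i < s.reg j → ∃ T τ', T + 1 + τ' ≤ τ ∧ Run B p s T (I τ'))
    (hexit : ∀ τ s, I τ s → ¬ s.reg i < s.reg j → 1 ≤ τ ∧ Q s) {τ : ℕ} {s : State} (h : I τ s) :
    Run B (.loop i j p) s τ Q := by
  induction τ using Nat.strong_induction_on generalizing s with
  | _ τ ih =>
    by_cases hlt : s.reg i < s.reg j
    · obtain ⟨T, τ', hT, s', T', h1, h2, h3⟩ := hstep τ s h hlt
      obtain ⟨s'', T'', h4, h5, h6⟩ := ih τ' (by omega) h3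
      exact ⟨s'', _, .loop_true hlt h1 h4, by omega, h6⟩
    · obtain ⟨h1, h2⟩ := hexit τ s h hlt
      exact ⟨s, 1, .loop_false hlt, h1, h2⟩

/-- A loop that is executed `m` times. -/
theorem Run.forLoop {p : Prog} {i j : ℕ} (I : ℕ → State → Prop) (m T : ℕ)
    (hlt : ∀ k ≤ m, ∀ s, I k s → (s.reg i < s.reg j ↔ k < m))
    (hstep : ∀ k < m, ∀ s, I k s → Run B p s T (I (k + 1))) {s : State} (h : I 0 s) :
    Run B (.loop i j p) s (m * (T + 1) + 1) (I m) := by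
  refine Run.loop (fun τ s => ∃ k ≤ m, τ = (m - k) * (T + 1) + 1 ∧ I k s) ?_ ?_
    ⟨0, Nat.zero_le m, by simp, h⟩
  · rintro τ s ⟨k, hk, rfl, hI⟩ hij
    have hkm := (hlt k hk s hI).1 hij
    refine ⟨T, (m - (k + 1)) * (T + 1) + 1, ?_, ?_⟩
    · obtain ⟨l, hl⟩ : ∃ l, m - k = l + 1 := ⟨m - k - 1, by omega⟩
      rw [hl, show m - (k + 1) = l by omega, add_mul]
      omega
    · exact (hstep k hkm s hI).mono le_rfl fun s hs => ⟨k + 1, hkm, rfl, hs⟩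
  · rintro τ s ⟨k, hk, rfl, hI⟩ hij
    refine ⟨by omega, ?_⟩
    have := (hlt k hk s hI).not.1 hij
    rwa [show m = k by omega]

/-! ### The encoding of the input -/

section Encode

variable {n : ℕ} (adj : Fin n → List (Fin n)) (r : Fin n)

/-- The total length of the adjacency lists of the vertices below `k`. -/
def offset (k : ℕ) : ℕ := (((List.finRange n).take k).map fun v => (adj v).length).sum

theorem offset_succ (v : Fin n) : offset adj (v.val + 1) = offset adj v.val + (adj v).length := by
  have hv : v.val < (List.finRange n).length := by simp
  rw [offset, offset, List.take_succ_eq_append_getElem hv]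
  simp

theorem offset_mono {k l : ℕ} (h : k ≤ l) : offset adj k ≤ offset adj l := by
  obtain ⟨m, rfl⟩ := Nat.exists_eq_add_of_le h
  rw [offset, offset, List.take_add]
  simp

theorem offset_card : offset adj n = ∑ v, (adj v).length := by
  rw [offset, List.take_of_length_le (by simp), ← List.sum_ofFn, List.ofFn_eq_map]

theorem encode_zero : (encode adj r).getD 0 0 = n := by simp [encode]

theorem encode_one : (encode adj r).getD 1 0 = r.val := by simp [encode]

theorem encode_offset {k : ℕ} (hk : k ≤ n) : (encode adj r).getD (2 + k) 0 = offset adj k := by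
  rw [encode, List.append_assoc, List.getD_append_right _ _ _ _ (by simp),
    List.getD_append _ _ _ _ (by simp; omega)]
  simp [offset, List.getD_eq_getElem?_getD, Nat.lt_succ_of_le hk]

theorem getD_flatMap {α : Type*} (f : α → List ℕ) (l : List α) {k i : ℕ} (hk : k < l.length)
    (hi : i < (f l[k]).length) :
    (l.flatMap f).getD (((l.take k).map fun v => (f v).length).sum + i) 0 = (f l[k])[i] := by
  induction l generalizing k with
  | nil => simp at hk
  | cons a l ih =>
    cases k with
    | zero =>
      simp only [List.getElem_cons_zero] at hi ⊢
      simp only [List.flatMap_cons, List.take_zero, List.map_nil, List.sum_nil, zero_add]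
      rw [List.getD_append _ _ _ _ hi]
      exact List.getD_eq_getElem _ _ hi
    | succ k =>
      simp only [List.getElem_cons_succ] at hi ⊢
      simp only [List.flatMap_cons, List.take_succ_cons, List.map_cons, List.sum_cons]
      rw [List.getD_append_right _ _ _ _ (by omega), ← ih (by simpa using hk) hi]
      congr 1
      omega

/-- The lists begin at address `n + 3`, after two header cells and `n + 1` offsets. -/
theorem encode_adj (v : Fin n) {i : ℕ} (hi : i < (adj v).length) :
    (encode adj r).getD (n + 3 + (offset adj v.val + i)) 0 = ((adj v)[i]).val := by
  have := getD_flatMap (fun v => (adj v).map Fin.val) (List.finRange n) (k := v.val) (i := i)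
    (by simp) (by simpa using hi)
  simp only [List.length_map, List.getElem_finRange, List.getElem_map] at this
  rw [← offset] at this
  rw [encode, List.getD_append_right]
  · refine Eq.trans ?_ this
    congr 1
    simp only [List.length_append, List.length_cons, List.length_nil, List.length_map,
      List.length_range]
    omega
  · simp

/-- Twice the number `n - 1` of edges. The input thus fills `3n + 1 ≤ 4n` cells, and the working
arrays from address `4n` on do not touch it. -/
theorem sum_length_adj {G : SimpleGraph (Fin n)} (hG : G.IsTree) (hadj : IsAdjLists G adj) :
    ∑ v, (adj v).length + 2 = 2 * n := by
  classical
  have h1 := G.sum_degrees_eq_twice_card_edges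
  have h2 := hG.card_edgeFinset
  have h3 : ∀ v, (adj v).length = G.degree v := by
    intro v
    rw [← List.toFinset_card_of_nodup (hadj v).1, ← G.card_neighborFinset_eq_degree]
    congr 1
    ext w
    simp [(hadj v).2]
  simp only [h3, h1]
  rw [Fintype.card_fin] at h2
  omega

end Encode

end RAM

/-! ### The program

Registers that keep their meaning: `R 0 = 0`, `R 1 = n`, `R 2` is the root, `R 3` bounds the
coordinates of the vectors, `R 4 = 1`, the current fraction is `R 6 / R 5`, `R 7` is the height of
the stack, and `R 8`, …, `R 11` are the addresses of the parents, the abscissas, the ordinates, and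
the stack, `R 12` is the address of the concatenated adjacency lists. -/

namespace RAM

open Fractions

variable {B n : ℕ}

/-- Compare the smallest fraction with denominator `R 21` above the current one with the best
fraction `R 24 / R 23` found so far. -/
def searchBody : Prog := block [
  .op .mul 25 6 21, .op .div 25 25 5, .op .add 25 25 4,
  .op .add 26 21 4, .op .mul 27 21 25, .op .add 27 27 27,
  .op .mul 28 25 23, .op .mul 29 24 21,
  .cond 25 26 (.cond 27 3 (.cond 28 29 (block [.op .add 23 21 0, .op .add 24 25 0])
    .skip) .skip) .skip,
  .op .add 21 21 4, .op .mul 22 21 21]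

/-- Advance to the next fraction. -/
def searchProg : Prog := block [
  .const 21 1, .const 22 1, .const 23 0, .const 24 1,
  .loop 22 3 searchBody,
  .op .add 5 23 0, .op .add 6 24 0]

/-- The largest bound needed is for twice the product of denominator and candidate numerator, `2 ·
8n · 65n² = 1040 n³`. It is the reason for a cubic word bound. The quotient is bounded by its
dividend, without assumptions on `A`. -/
theorem run_searchBody {N A b k : ℕ} (hB : 2000 * n ^ 3 ≤ B) (hN : N + 1 ≤ 8 * n)
    (hb : b ≤ N + 1) (hk : k ≤ N) {s : State} (h0 : s.reg 0 = 0)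
    (h3 : s.reg 3 = N) (h4 : s.reg 4 = 1) (h5 : s.reg 5 = A) (h6 : s.reg 6 = b)
    (h21 : s.reg 21 = k + 1) (h23 : s.reg 23 = (search N A b k).1)
    (h24 : s.reg 24 = (search N A b k).2) :
    Run B searchBody s 20 fun s' => s'.mem = s.mem ∧ (∀ i < 21, s'.reg i = s.reg i) ∧
      s'.reg 21 = k + 2 ∧ s'.reg 22 = (k + 2) * (k + 2) ∧
      s'.reg 23 = (search N A b (k + 1)).1 ∧ s'.reg 24 = (search N A b (k + 1)).2 := by
  obtain ⟨b1, b2⟩ := search_bounds N A b k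
  have hn : 1 ≤ n := by omega
  have hn2 : n ≤ n ^ 2 := Nat.le_self_pow (by norm_num) n
  have hn3 : n ^ 2 ≤ n ^ 3 := Nat.pow_le_pow_right hn (by norm_num)
  have e1 : b * (k + 1) ≤ 64 * n ^ 2 := by
    calc b * (k + 1) ≤ (8 * n) * (8 * n) := Nat.mul_le_mul (by omega) (by omega)
      _ = 64 * n ^ 2 := by ring
  have e2 : b * (k + 1) / A ≤ 64 * n ^ 2 := (Nat.div_le_self _ _).trans e1
  have e3 : (k + 1) * (b * (k + 1) / A + 1) ≤ 520 * n ^ 3 := by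
    calc (k + 1) * (b * (k + 1) / A + 1) ≤ (8 * n) * (65 * n ^ 2) :=
          Nat.mul_le_mul (by omega) (by omega)
      _ = 520 * n ^ 3 := by ring
  have e4 : (b * (k + 1) / A + 1) * (search N A b k).1 ≤ 520 * n ^ 3 := by
    calc (b * (k + 1) / A + 1) * (search N A b k).1 ≤ (65 * n ^ 2) * (8 * n) :=
          Nat.mul_le_mul (by omega) (by omega)
      _ = 520 * n ^ 3 := by ring
  have e5 : (search N A b k).2 * (k + 1) ≤ 64 * n ^ 2 := by
    calc (search N A b k).2 * (k + 1) ≤ (8 * n) * (8 * n) := Nat.mul_le_mul (by omega) (by omega)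
      _ = 64 * n ^ 2 := by ring
  have e6 : (k + 1 + 1) * (k + 1 + 1) ≤ 256 * n ^ 2 := by
    calc (k + 1 + 1) * (k + 1 + 1) ≤ (16 * n) * (16 * n) :=
          Nat.mul_le_mul (by omega) (by omega)
      _ = 256 * n ^ 2 := by ring
  refine .consOp (b * (k + 1)) (by simp [BinOp.eval, h6, h21]) (by omega) ?_
  refine .consOp (b * (k + 1) / A) (by simp [BinOp.eval, h5]) (by omega) ?_
  refine .consOp (b * (k + 1) / A + 1) (by simp [BinOp.eval, h4]) (by omega) ?_
  refine .consOp (k + 1 + 1) (by simp [BinOp.eval, h4, h21]) (by omega) ?_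
  refine .consOp ((k + 1) * (b * (k + 1) / A + 1)) (by simp [BinOp.eval, h21]) (by omega) ?_
  refine .consOp (2 * ((k + 1) * (b * (k + 1) / A + 1)))
    (by simp [BinOp.eval, two_mul]) (by omega) ?_
  refine .consOp ((b * (k + 1) / A + 1) * (search N A b k).1) (by simp [BinOp.eval, h23])
    (by omega) ?_
  refine .consOp ((search N A b k).2 * (k + 1)) (by simp [BinOp.eval, h21, h24]) (by omega) ?_
  have hend : ∀ s', s'.mem = s.mem → (∀ i < 21, s'.reg i = s.reg i) → s'.reg 21 = k + 1 →
      s'.reg 23 = (search N A b (k + 1)).1 → s'.reg 24 = (search N A b (k + 1)).2 →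
      Run B (block [.op .add 21 21 4, .op .mul 22 21 21]) s' 3 fun s' =>
        s'.mem = s.mem ∧ (∀ i < 21, s'.reg i = s.reg i) ∧
        s'.reg 21 = k + 2 ∧ s'.reg 22 = (k + 2) * (k + 2) ∧
        s'.reg 23 = (search N A b (k + 1)).1 ∧ s'.reg 24 = (search N A b (k + 1)).2 := by
    intro s' f1 f2 f3 f4 f5
    refine .consOp (k + 1 + 1) (by simp [BinOp.eval, f2, h4, f3]) (by omega) ?_
    refine .consOp ((k + 1 + 1) * (k + 1 + 1)) (by simp [BinOp.eval]) (by omega) ?_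
    refine .nil ⟨f1, fun i hi => ?_, by simp, by simp, by simpa using f4, by simpa using f5⟩
    simp [f2 i hi, show i ≠ 22 by omega, show i ≠ 21 by omega]
  have hframe : ∀ i < 21, i ≠ 25 ∧ i ≠ 26 ∧ i ≠ 27 ∧ i ≠ 28 ∧ i ≠ 29 ∧ i ≠ 23 ∧ i ≠ 24 := by
    intro i hi
    omega
  refine .cons 6 3 ?_ (by omega)
  refine .cond (fun c1 => .cond (fun c2 => .cond (fun c3 => ?_) fun c3 => ?_) fun c2 => ?_)
    fun c1 => ?_
  · refine .consOp (k + 1) (by simp [BinOp.eval, h21, h0]) (by omega) ?_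
    refine .consOp (b * (k + 1) / A + 1) (by simp [BinOp.eval, h0]) (by omega) ?_
    simp [h3] at c1 c2 c3
    have hs : search N A b (k + 1) = (k + 1, b * (k + 1) / A + 1) := by
      rw [search, searchStep, if_pos ⟨by omega, c2, c3⟩]
    refine .nil (hend _ rfl (fun i hi => ?_) ?_ ?_ ?_)
    · simp [hframe i hi]
    · simp [h21]
    · simp [hs]
    · simp [hs]
  -- In the three remaining branches some condition of `searchStep` fails, and the best fraction is
  -- kept.
  all_goals
    simp [h3] at *
    have hs : search N A b (k + 1) = search N A b k := by
      rw [search, searchStep, if_neg]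
      rintro ⟨d1, d2, d3⟩
      omega
    refine .skip (by omega) (hend _ rfl (fun i hi => ?_) ?_ ?_ ?_)
    · simp [hframe i hi]
    · simp [h21]
    · simp [h23, hs]
    · simp [h24, hs]

theorem run_searchProg {N k : ℕ} (hB : 2000 * n ^ 3 ≤ B) (hN : N + 1 ≤ 8 * n)
    {s : State} (h0 : s.reg 0 = 0) (h3 : s.reg 3 = N) (h4 : s.reg 4 = 1)
    (h5 : s.reg 5 = (enum N k).1) (h6 : s.reg 6 = (enum N k).2) :
    Run B searchProg s (21 * Nat.sqrt (N - 1) + 8) fun s' => s'.mem = s.mem ∧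
      (∀ i < 21, i ≠ 5 → i ≠ 6 → s'.reg i = s.reg i) ∧
      s'.reg 5 = (enum N (k + 1)).1 ∧ s'.reg 6 = (enum N (k + 1)).2 := by
  have hn : 1 ≤ n := by omega
  have hn3 : n ≤ n ^ 3 := Nat.le_self_pow (by norm_num) n
  obtain ⟨-, bb⟩ := enum_bounds N k
  obtain ⟨bA', bb'⟩ := enum_bounds N (k + 1)
  refine .consConst (by omega) ?_
  refine .consConst (by omega) ?_
  refine .consConst (by omega) ?_
  refine .consConst (by omega) ?_
  refine .cons (Nat.sqrt (N - 1) * (20 + 1) + 1) 3 ?_ (by omega)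
  refine (Run.forLoop (fun l s' => s'.mem = s.mem ∧ (∀ i < 21, s'.reg i = s.reg i) ∧
      s'.reg 21 = l + 1 ∧ s'.reg 22 = (l + 1) * (l + 1) ∧
      s'.reg 23 = (search N (enum N k).1 (enum N k).2 l).1 ∧
      s'.reg 24 = (search N (enum N k).1 (enum N k).2 l).2) _ 20 ?_ ?_ ?_).mono le_rfl ?_
  -- The guard compares `(l + 1)²` with `N`, so the loop ends after `⌊√(N - 1)⌋` rounds although no
  -- square root is computed.
  · rintro l - s' ⟨-, f2, -, f4, -, -⟩
    rw [f4, f2 3 (by norm_num), h3]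
    have := @le_sqrt_pred N (l + 1)
    simp only [Nat.succ_pos, and_true] at this
    rw [← this]
    omega
  · rintro l hl s' ⟨f1, f2, f3, -, f5, f6⟩
    have hlN := hl.le.trans (Nat.sqrt_le_self (N - 1))
    have := run_searchBody (n := n) (s := s') hB hN bb (show l ≤ N by omega)
      (by simp [f2, h0]) (by simp [f2, h3]) (by simp [f2, h4]) (by simp [f2, h5])
      (by simp [f2, h6]) f3 f5 f6
    refine this.mono le_rfl ?_
    rintro s'' ⟨g1, g2, g3⟩
    exact ⟨g1.trans f1, fun i hi => (g2 i hi).trans (f2 i hi), g3⟩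
  · refine ⟨rfl, fun i hi => ?_, by simp, by simp, by simp [search], by simp [search]⟩
    simp [show i ≠ 21 by omega, show i ≠ 22 by omega, show i ≠ 23 by omega,
      show i ≠ 24 by omega]
  · rintro s' ⟨f1, f2, -, -, f5, f6⟩
    change s'.reg 23 = (enum N (k + 1)).1 at f5
    change s'.reg 24 = (enum N (k + 1)).2 at f6
    refine .consOp (enum N (k + 1)).1 (by simp [BinOp.eval, f5, f2, h0]) (by omega) ?_
    refine .consOp (enum N (k + 1)).2 (by simp [BinOp.eval, f6, f2, h0]) (by omega) ?_
    refine .nil ⟨f1, fun i hi h5 h6 => ?_, by simp, by simp⟩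
    simp [h5, h6, f2 i hi]

end RAM

/-! ### The traversal -/

namespace RAM

open Fractions RootedTree Drawing

variable {B n N : ℕ} {G : SimpleGraph (Fin n)} {r : Fin n} {adj : Fin n → List (Fin n)}

/-- Take the vertex `R 13` from the stack and compute its position from that of its parent. -/
def visitProg : Prog := block [
  .op .sub 7 7 4, .op .add 19 11 7, .load 13 19, .op .add 19 8 13, .load 14 19,
  .op .mul 20 5 5, .op .mul 21 6 6, .op .sub 20 20 21,
  .op .add 19 9 14, .load 21 19, .op .add 20 20 21, .op .add 19 9 13, .store 19 20,
  .op .mul 20 5 6, .op .add 20 20 20,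
  .op .add 19 10 14, .load 21 19, .op .add 20 20 21, .op .add 19 10 13, .store 19 20,
  .op .add 15 7 0, .const 19 2, .op .add 19 19 13, .load 16 19, .op .add 19 19 4, .load 17 19]

/-- Push the neighbour at position `R 16` of the adjacency lists if it is not the parent. -/
def pushBody : Prog := block [
  .op .add 19 12 16, .load 18 19,
  ifNe 18 14 (block [.op .add 19 8 18, .store 19 13, .op .add 19 11 7, .store 19 18,
    .op .add 7 7 4]),
  .op .add 16 16 4]

/-- Visit one vertex, push its children, and advance to the next fraction if there are none. -/
def traverseBody : Prog := block [visitProg, .loop 16 17 pushBody, .cond 15 7 .skip searchProg]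

/-- The registers that do not change during the traversal. -/
structure Consts (n N : ℕ) (s : State) : Prop where
  zero : s.reg 0 = 0
  size : s.reg 1 = n
  bound : s.reg 3 = N
  one : s.reg 4 = 1
  parents : s.reg 8 = 4 * n
  abscissas : s.reg 9 = 5 * n
  ordinates : s.reg 10 = 6 * n
  stack : s.reg 11 = 7 * n
  lists : s.reg 12 = n + 3

theorem Consts.of_eq {s s' : State} (h : Consts n N s)
    (hr : ∀ i < 13, i ≠ 5 → i ≠ 6 → i ≠ 7 → s'.reg i = s.reg i) : Consts n N s' where
  zero := by rw [hr 0 (by decide) (by decide) (by decide) (by decide), h.zero]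
  size := by rw [hr 1 (by decide) (by decide) (by decide) (by decide), h.size]
  bound := by rw [hr 3 (by decide) (by decide) (by decide) (by decide), h.bound]
  one := by rw [hr 4 (by decide) (by decide) (by decide) (by decide), h.one]
  parents := by rw [hr 8 (by decide) (by decide) (by decide) (by decide), h.parents]
  abscissas := by rw [hr 9 (by decide) (by decide) (by decide) (by decide), h.abscissas]
  ordinates := by rw [hr 10 (by decide) (by decide) (by decide) (by decide), h.ordinates]
  stack := by rw [hr 11 (by decide) (by decide) (by decide) (by decide), h.stack]
  lists := by rw [hr 12 (by decide) (by decide) (by decide) (by decide), h.lists]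

/-- The memory holds the given stack, with the top first in the list. -/
def StackAt (mem : ℕ → ℕ) (base : ℕ) : List (Fin n) → Prop
  | [] => True
  | v :: S => mem (base + S.length) = v.val ∧ StackAt mem base S

theorem StackAt.congr {mem mem' : ℕ → ℕ} {base : ℕ} {S : List (Fin n)} (h : StackAt mem base S)
    (hm : ∀ a, base ≤ a → a < base + S.length → mem' a = mem a) : StackAt mem' base S := by
  induction S with
  | nil => trivial
  | cons v S ih =>
    refine ⟨?_, ih h.2 fun a h1 h2 => hm a h1 ?_⟩
    · rw [hm _ (by omega) (by simp), h.1]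
    · simp only [List.length_cons]
      omega

/-- The directions available to the subtrees of the vertices on the stack are consecutive
intervals that start at `k`. -/
def Planned (G : SimpleGraph (Fin n)) (r : Fin n) (ch : Fin n → List (Fin n)) :
    List (Fin n) → ℕ → Prop
  | [], _ => True
  | v :: S, k => firstLeaf G r ch v = k ∧ Planned G r ch S (k + leaves G r ch v)

/-- The interval of `v` is divided among its children, and `S` continues where it ends. The claim
concerns a suffix `l₂` of the children, so that the induction can move the boundary. -/
theorem Planned.append_children (hG : G.IsTree) {ch : Fin n → List (Fin n)}
    (hch : IsChildLists G r ch) {v : Fin n} {S l₁ l₂ : List (Fin n)} {k : ℕ}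
    (hS : Planned G r ch S k) (h : ch v = l₁ ++ l₂)
    (hk : k = firstLeaf G r ch v + ((ch v).map (leaves G r ch)).sum) :
    Planned G r ch (l₂ ++ S) (firstLeaf G r ch v + (l₁.map (leaves G r ch)).sum) := by
  induction l₂ generalizing l₁ with
  | nil =>
    subst hk
    simpa [h] using hS
  | cons c l₂ ih =>
    refine ⟨firstLeaf_child hG hch h, ?_⟩
    have := ih (l₁ := l₁ ++ [c]) (by simp [h])
    simpa [add_assoc] using this

open Classical in
/-- The children of `v` in the order in which the traversal visits them. -/
noncomputable def childList (G : SimpleGraph (Fin n)) (r : Fin n) (adj : Fin n → List (Fin n))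
    (v : Fin n) : List (Fin n) :=
  ((adj v).filter fun w => w ≠ parent G r v).reverse

theorem isChildLists_childList (hG : G.IsTree) (hadj : IsAdjLists G adj) :
    IsChildLists G r (childList G r adj) := by
  intro v
  refine ⟨by simpa [childList] using (hadj v).1.filter _, fun w => ?_⟩
  rw [isChild_iff_adj_and_ne hG]
  simp [childList, (hadj v).2]

/-- The invariant of the traversal: `W` is the set of visited vertices, `S` is the stack, and `k`
is the number of leaves visited. -/
structure TraverseInv (G : SimpleGraph (Fin n)) (r : Fin n) (adj : Fin n → List (Fin n)) (N : ℕ)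
    (W : Finset (Fin n)) (S : List (Fin n)) (k : ℕ) (s : State) : Prop where
  consts : Consts n N s
  input : ∀ a < 4 * n, s.mem a = (encode adj r).getD a 0
  nodup : S.Nodup
  disjoint : ∀ v ∈ S, v ∉ W
  cover : ∀ v, (v ∈ W ∨ v ∈ S) ↔ (v = r ∨ parent G r v ∈ W)
  planned : Planned G r (childList G r adj) S k
  frac_fst : s.reg 5 = (enum N k).1
  frac_snd : s.reg 6 = (enum N k).2
  height : s.reg 7 = S.length
  stack : StackAt s.mem (7 * n) S
  parents : ∀ v ∈ S, s.mem (4 * n + v.val) = (parent G r v).val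
  abscissas : ∀ v ∈ W,
    s.mem (5 * n + v.val) = (position G r (childList G r adj) (vec N) v).1
  ordinates : ∀ v ∈ W,
    s.mem (6 * n + v.val) = (position G r (childList G r adj) (vec N) v).2
  root : r ∈ S → s.mem (5 * n + r.val) = 0 ∧ s.mem (6 * n + r.val) = 0

theorem offset_le (hG : G.IsTree) (hadj : IsAdjLists G adj) {k : ℕ} (hk : k ≤ n) :
    offset adj k + 2 ≤ 2 * n := by
  rw [← sum_length_adj adj hG hadj, ← offset_card]
  have := offset_mono adj hk
  omega

theorem position_vec_le (hG : G.IsTree) (hN : N + 1 ≤ 8 * n) (ch : Fin n → List (Fin n))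
    (v : Fin n) : (position G r ch (vec N) v).1 ≤ 128 * n ^ 3 ∧
      (position G r ch (vec N) v).2 ≤ 128 * n ^ 3 := by
  have h1 : 2 * (N + 1) ^ 2 ≤ 128 * n ^ 2 := by
    calc 2 * (N + 1) ^ 2 ≤ 2 * (8 * n) ^ 2 := by gcongr
      _ = 128 * n ^ 2 := by ring
  have h2 := position_le (r := r) hG ch (vec N)
    (fun k => ⟨(vec_le N k).1.trans h1, (vec_le N k).2.trans h1⟩) v
  have h3 : (G.dist r v + 1) * (128 * n ^ 2) ≤ 128 * n ^ 3 := by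
    have := dist_lt_card (r := r) hG v
    rw [Fintype.card_fin] at this
    calc (G.dist r v + 1) * (128 * n ^ 2) ≤ n * (128 * n ^ 2) := by gcongr; omega
      _ = 128 * n ^ 3 := by ring
  exact ⟨h2.1.trans h3, h2.2.trans h3⟩

/-- By `planned`, the current index `k` is the first leaf below `v`, so the current fraction is the
one for the edge into `v`. For the root both stored coordinates are `0` and `k = 0`. -/
theorem TraverseInv.position_eq (hG : G.IsTree) {W : Finset (Fin n)} {S : List (Fin n)} {k : ℕ}
    {s : State} {v : Fin n} (h : TraverseInv G r adj N W (v :: S) k s) :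
    s.mem (5 * n + (parent G r v).val) + (vec N k).1
        = (position G r (childList G r adj) (vec N) v).1 ∧
      s.mem (6 * n + (parent G r v).val) + (vec N k).2
        = (position G r (childList G r adj) (vec N) v).2 := by
  have hk : firstLeaf G r (childList G r adj) v = k := h.planned.1
  by_cases hv : v = r
  · subst hv
    rw [firstLeaf_root] at hk
    subst hk
    obtain ⟨h1, h2⟩ := h.root (by simp)
    rw [parent_root, position_root, h1, h2]
    simp
  · have hp : parent G r v ∈ W := ((h.cover v).1 (Or.inr (by simp))).resolve_left hv
    rw [position_child hG _ _ (isChild_parent hG hv), hk, h.abscissas _ hp, h.ordinates _ hp]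
    simp

theorem run_visitProg (hG : G.IsTree) (hadj : IsAdjLists G adj) (hB : 2000 * n ^ 3 ≤ B)
    (hN : N + 1 ≤ 8 * n) {W : Finset (Fin n)} {S : List (Fin n)} {k : ℕ} {s : State} {v : Fin n}
    (h : TraverseInv G r adj N W (v :: S) k s) :
    Run B visitProg s 27 fun s' => (∀ i < 13, i ≠ 7 → s'.reg i = s.reg i) ∧
      s'.reg 7 = S.length ∧ s'.reg 13 = v.val ∧ s'.reg 14 = (parent G r v).val ∧
      s'.reg 15 = S.length ∧ s'.reg 16 = offset adj v.val ∧
      s'.reg 17 = offset adj (v.val + 1) ∧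
      ∀ a, s'.mem a =
        if a = 6 * n + v.val then (position G r (childList G r adj) (vec N) v).2
        else if a = 5 * n + v.val then (position G r (childList G r adj) (vec N) v).1
        else s.mem a := by
  have hvn := v.isLt
  have hpn := (parent G r v).isLt
  have hn : 1 ≤ n := by omega
  have hn2 : n ≤ n ^ 2 := Nat.le_self_pow (by norm_num) n
  have hn3 : n ^ 2 ≤ n ^ 3 := Nat.pow_le_pow_right hn (by norm_num)
  have hSn : (v :: S).length ≤ n := by
    simpa using h.nodup.length_le_card
  have hlen : (v :: S).length = S.length + 1 := rfl
  obtain ⟨p1, p2⟩ := h.position_eq hG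
  obtain ⟨q1, q2⟩ := position_vec_le (r := r) hG hN (childList G r adj) v
  obtain ⟨bA, bb⟩ := enum_bounds N k
  have sq : ∀ x y, x ≤ N + 1 → y ≤ N + 1 → x * y ≤ 64 * n ^ 2 := fun x y hx hy =>
    calc x * y ≤ (8 * n) * (8 * n) := Nat.mul_le_mul (by omega) (by omega)
      _ = 64 * n ^ 2 := by ring
  have e1 := sq _ _ bA bA
  have e2 := sq _ _ bb bb
  have e3 := sq _ _ bA bb
  have o1 := offset_le hG hadj (k := v.val) (by omega)
  have o2 := offset_le hG hadj (k := v.val + 1) (by omega)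
  have c0 := h.consts.zero
  have c1 := h.consts.one
  have c8 := h.consts.parents
  have c9 := h.consts.abscissas
  have c10 := h.consts.ordinates
  have c11 := h.consts.stack
  have h5 := h.frac_fst
  have h6 := h.frac_snd
  have h7 := h.height
  have v1 : (vec N k).1 = (enum N k).1 * (enum N k).1 - (enum N k).2 * (enum N k).2 := rfl
  have v2 : (vec N k).2 = 2 * ((enum N k).1 * (enum N k).2) := rfl
  refine .consOp S.length (by simp [BinOp.eval, h7, c1]) (by omega) ?_
  refine .consOp (7 * n + S.length) (by simp [BinOp.eval, c11]) (by omega) ?_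
  refine .consLoad v.val (by simpa using h.stack.1) (by omega) ?_
  refine .consOp (4 * n + v.val) (by simp [BinOp.eval, c8]) (by omega) ?_
  refine .consLoad (parent G r v).val (by simpa using h.parents v (by simp)) (by omega) ?_
  refine .consOp ((enum N k).1 * (enum N k).1) (by simp [BinOp.eval, h5]) (by omega) ?_
  refine .consOp ((enum N k).2 * (enum N k).2) (by simp [BinOp.eval, h6]) (by omega) ?_
  refine .consOp (vec N k).1 (by simp [BinOp.eval, v1]) (by omega) ?_
  refine .consOp (5 * n + (parent G r v).val) (by simp [BinOp.eval, c9]) (by omega) ?_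
  refine .consLoad (s.mem (5 * n + (parent G r v).val)) (by simp) (by omega) ?_
  refine .consOp (position G r (childList G r adj) (vec N) v).1
    (by simp [BinOp.eval, ← p1, add_comm]) (by omega) ?_
  refine .consOp (5 * n + v.val) (by simp [BinOp.eval, c9]) (by omega) ?_
  refine .consStore (5 * n + v.val) (position G r (childList G r adj) (vec N) v).1
    (by simp) (by simp) (by omega) ?_
  refine .consOp ((enum N k).1 * (enum N k).2) (by simp [BinOp.eval, h5, h6]) (by omega) ?_
  refine .consOp (vec N k).2 (by simp [BinOp.eval, v2, two_mul]) (by omega) ?_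
  refine .consOp (6 * n + (parent G r v).val) (by simp [BinOp.eval, c10]) (by omega) ?_
  refine .consLoad (s.mem (6 * n + (parent G r v).val))
    (by simp [show 6 * n + (parent G r v).val ≠ 5 * n + v.val by omega]) (by omega) ?_
  refine .consOp (position G r (childList G r adj) (vec N) v).2
    (by simp [BinOp.eval, ← p2, add_comm]) (by omega) ?_
  refine .consOp (6 * n + v.val) (by simp [BinOp.eval, c10]) (by omega) ?_
  refine .consStore (6 * n + v.val) (position G r (childList G r adj) (vec N) v).2
    (by simp) (by simp) (by omega) ?_
  -- `R 15` keeps the height after the removal of `v`; comparing it later with `R 7` reveals whether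
  -- `v` has children.
  refine .consOp S.length (by simp [BinOp.eval, c0]) (by omega) ?_
  refine .consConst (by omega) ?_
  refine .consOp (2 + v.val) (by simp [BinOp.eval]) (by omega) ?_
  refine .consLoad (offset adj v.val) ?_ (by omega) ?_
  · simp [show 2 ≠ 6 * n by omega, show 2 ≠ 5 * n by omega]
    rw [h.input _ (by omega), encode_offset adj r (by omega)]
  refine .consOp (2 + (v.val + 1)) (by simp [BinOp.eval, c1, add_assoc]) (by omega) ?_
  refine .consLoad (offset adj (v.val + 1)) ?_ (by omega) ?_
  · simp [show 2 + (v.val + 1) ≠ 6 * n + v.val by omega,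
      show 2 + (v.val + 1) ≠ 5 * n + v.val by omega]
    rw [h.input _ (by omega), encode_offset adj r (by omega)]
  refine .nil ⟨fun i hi hi7 => ?_, by simp, by simp, by simp, by simp, by simp, by simp,
    fun a => by simp⟩
  simp [hi7, show i ≠ 13 by omega, show i ≠ 14 by omega, show i ≠ 15 by omega,
    show i ≠ 16 by omega, show i ≠ 17 by omega, show i ≠ 19 by omega, show i ≠ 20 by omega,
    show i ≠ 21 by omega]

open Classical in
/-- The children among the first `i` neighbours of `v`. -/
noncomputable def pushed (G : SimpleGraph (Fin n)) (r : Fin n) (adj : Fin n → List (Fin n))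
    (v : Fin n) (i : ℕ) : List (Fin n) :=
  (((adj v).take i).filter fun w => w ≠ parent G r v).reverse

/-- The invariant of the loop that pushes the children of `v` on the stack `S`. -/
structure PushInv (G : SimpleGraph (Fin n)) (r : Fin n) (adj : Fin n → List (Fin n)) (v : Fin n)
    (S : List (Fin n)) (s : State) (i : ℕ) (s' : State) : Prop where
  reg : ∀ j < 18, j ≠ 7 → j ≠ 16 → s'.reg j = s.reg j
  index : s'.reg 16 = offset adj v.val + i
  height : s'.reg 7 = (pushed G r adj v i ++ S).length
  stack : StackAt s'.mem (7 * n) (pushed G r adj v i ++ S)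
  mem : ∀ a < 7 * n, (∀ w ∈ pushed G r adj v i, a ≠ 4 * n + w.val) → s'.mem a = s.mem a
  parents : ∀ w ∈ pushed G r adj v i, s'.mem (4 * n + w.val) = v.val

/-- A neighbour is a child unless it is the parent. The root is stored as its own parent, hence none
of its neighbours is left out. -/
theorem run_pushBody (hG : G.IsTree) (hadj : IsAdjLists G adj) (hB : 2000 * n ^ 3 ≤ B)
    {S : List (Fin n)} (hS : S.length ≤ n) {s : State} {v : Fin n} (hc : Consts n N s)
    (hin : ∀ a < 4 * n, s.mem a = (encode adj r).getD a 0) (h13 : s.reg 13 = v.val)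
    (h14 : s.reg 14 = (parent G r v).val) {i : ℕ} (hi : i < (adj v).length) {s' : State}
    (h : PushInv G r adj v S s i s') :
    Run B pushBody s' 12 (PushInv G r adj v S s (i + 1)) := by
  have hvn := v.isLt
  have hn : 1 ≤ n := by omega
  have hn2 : n ≤ n ^ 3 := Nat.le_self_pow (by norm_num) n
  have o2 := offset_le hG hadj (k := v.val + 1) (by omega)
  have o1 := offset_succ adj v
  have hwn := ((adj v)[i]).isLt
  have hpl : (pushed G r adj v i).length ≤ i := by
    rw [pushed, List.length_reverse]
    exact (List.length_filter_le _ _).trans (by simp)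
  have hl := h.height
  rw [List.length_append] at hl
  have c4 : s'.reg 4 = 1 := by rw [h.reg 4 (by decide) (by decide) (by decide), hc.one]
  have c8 : s'.reg 8 = 4 * n := by rw [h.reg 8 (by decide) (by decide) (by decide), hc.parents]
  have c11 : s'.reg 11 = 7 * n := by rw [h.reg 11 (by decide) (by decide) (by decide), hc.stack]
  have c12 : s'.reg 12 = n + 3 := by rw [h.reg 12 (by decide) (by decide) (by decide), hc.lists]
  have c13 : s'.reg 13 = v.val := by rw [h.reg 13 (by decide) (by decide) (by decide), h13]
  have c14 : s'.reg 14 = (parent G r v).val := by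
    rw [h.reg 14 (by decide) (by decide) (by decide), h14]
  have h16 := h.index
  refine .consOp (n + 3 + (offset adj v.val + i)) (by simp [BinOp.eval, c12, h16]) (by omega) ?_
  refine .consLoad ((adj v)[i]).val ?_ (by omega) ?_
  · simp only [State.reg_setReg, if_true, State.mem_setReg]
    rw [h.mem _ (by omega) (fun w _ => by omega), hin _ (by omega), encode_adj adj r v hi]
  have htake : (adj v).take (i + 1) = (adj v).take i ++ [(adj v)[i]] :=
    List.take_succ_eq_append_getElem hi
  refine .cons 8 2 (.ifNe (T := 6) (by omega) (fun hne => ?_) fun heq => ?_) (by omega)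
  · simp [c14] at hne
    have hp : pushed G r adj v (i + 1) = (adj v)[i] :: pushed G r adj v i := by
      rw [pushed, htake, List.filter_append, List.reverse_append, pushed]
      simp [Fin.val_ne_iff.1 hne]
    refine .consOp (4 * n + ((adj v)[i]).val) (by simp [BinOp.eval, c8]) (by omega) ?_
    refine .consStore (4 * n + ((adj v)[i]).val) v.val (by simp) (by simp [c13]) (by omega) ?_
    refine .consOp (7 * n + s'.reg 7) (by simp [BinOp.eval, c11]) (by omega) ?_
    refine .consStore (7 * n + s'.reg 7) ((adj v)[i]).val (by simp) (by simp) (by omega) ?_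
    refine .consOp (s'.reg 7 + 1) (by simp [BinOp.eval, c4]) (by omega) ?_
    refine .nil ?_
    refine .consOp (offset adj v.val + (i + 1)) (by simp [BinOp.eval, h16, c4]; omega)
      (by omega) ?_
    refine .nil ⟨fun j hj h7 h16 => ?_, by simp, ?_, ?_, ?_, ?_⟩
    · simp [h7, h16, show j ≠ 18 by omega, show j ≠ 19 by omega, h.reg j hj h7 h16]
    · simp [hp, hl]
    · rw [hp, List.cons_append]
      refine ⟨?_, h.stack.congr fun a h1 h2 => ?_⟩
      · simp [hl]
      · rw [List.length_append] at h2
        simp [show a ≠ 7 * n + s'.reg 7 by omega, show a ≠ 4 * n + ((adj v)[i]).val by omega]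
    · intro a ha hw
      rw [hp] at hw
      have := hw _ List.mem_cons_self
      simp [show a ≠ 7 * n + s'.reg 7 by omega, this]
      exact h.mem a ha fun w hm => hw w (List.mem_cons_of_mem _ hm)
    · intro w hw
      have hwlt := w.isLt
      rw [hp, List.mem_cons] at hw
      by_cases hwi : w = (adj v)[i]
      · simp [hwi, show 4 * n + ((adj v)[i]).val ≠ 7 * n + s'.reg 7 by omega]
      · have hne' : w.val ≠ ((adj v)[i]).val := Fin.val_ne_iff.2 hwi
        simp [hne', show 4 * n + w.val ≠ 7 * n + s'.reg 7 by omega]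
        exact h.parents w (hw.resolve_left hwi)
  · simp [c14] at heq
    have hp : pushed G r adj v (i + 1) = pushed G r adj v i := by
      rw [pushed, htake, List.filter_append, List.reverse_append, pushed]
      simp [Fin.val_inj.1 heq]
    refine .consOp (offset adj v.val + (i + 1)) (by simp [BinOp.eval, h16, c4]; omega)
      (by omega) ?_
    refine .nil ⟨fun j hj h7 h16 => ?_, by simp, ?_, ?_, ?_, ?_⟩
    · simp [h16, show j ≠ 18 by omega, show j ≠ 19 by omega, h.reg j hj h7 h16]
    · simp [hp, hl]
    · simpa [hp] using h.stack
    · simpa [hp] using h.mem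
    · simpa [hp] using h.parents

end RAM

/-! ### One round of the traversal, and its running time charged to the vertices -/

namespace RAM

open Fractions RootedTree Drawing

variable {B n N : ℕ} {G : SimpleGraph (Fin n)} {r : Fin n} {adj : Fin n → List (Fin n)}

theorem pushed_length (v : Fin n) :
    pushed G r adj v (adj v).length = childList G r adj v := by
  rw [pushed, childList, List.take_length]

/-- By `cover`, the children of `v` are neither visited nor on the stack, since their parent `v` was
not yet in `W`. Pushing them therefore repeats no entry and overwrites no parent that is still
needed. The index `k'` is left open because it depends on whether `v` is a leaf. -/
theorem TraverseInv.step (hG : G.IsTree) (hadj : IsAdjLists G adj) {W : Finset (Fin n)}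
    {S : List (Fin n)} {k k' : ℕ} {s s₁ s₂ s₃ : State} {v : Fin n}
    (h : TraverseInv G r adj N W (v :: S) k s)
    (hreg₁ : ∀ i < 13, i ≠ 7 → s₁.reg i = s.reg i)
    (hmem₁ : ∀ a, s₁.mem a =
        if a = 6 * n + v.val then (position G r (childList G r adj) (vec N) v).2
        else if a = 5 * n + v.val then (position G r (childList G r adj) (vec N) v).1
        else s.mem a)
    (h₂ : PushInv G r adj v S s₁ (adj v).length s₂) (hmem₃ : s₃.mem = s₂.mem)
    (hreg₃ : ∀ i < 13, i ≠ 5 → i ≠ 6 → s₃.reg i = s₂.reg i)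
    (h5 : s₃.reg 5 = (enum N k').1) (h6 : s₃.reg 6 = (enum N k').2)
    (hk' : Planned G r (childList G r adj) (childList G r adj v ++ S) k') :
    TraverseInv G r adj N (insert v W) (childList G r adj v ++ S) k' s₃ := by
  have hch := isChildLists_childList (r := r) hG hadj
  have hvn := v.isLt
  have hnd := List.nodup_cons.1 h.nodup
  have hvW : v ∉ W := h.disjoint v (by simp)
  have hmem := h₂.mem
  have hpar := h₂.parents
  have hst := h₂.stack
  have hht := h₂.height
  rw [pushed_length] at hmem hpar hst hht
  have hchild : ∀ u ∈ childList G r adj v, u ≠ r ∧ parent G r u = v := by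
    intro u hu
    have hc := ((hch v).2 u).1 hu
    refine ⟨?_, parent_eq hG hc⟩
    rintro rfl
    exact not_isChild_root _ hc
  have hfresh : ∀ u ∈ childList G r adj v, ¬ (u ∈ W ∨ u ∈ v :: S) := by
    intro u hu hu'
    obtain ⟨h1, h2⟩ := hchild u hu
    rcases (h.cover u).1 hu' with h3 | h3
    · exact h1 h3
    · exact hvW (h2 ▸ h3)
  have hX : ∀ u : Fin n, s₂.mem (5 * n + u.val) = s₁.mem (5 * n + u.val) := fun u =>
    hmem _ (by omega) fun w _ => by omega
  have hY : ∀ u : Fin n, s₂.mem (6 * n + u.val) = s₁.mem (6 * n + u.val) := fun u =>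
    hmem _ (by omega) fun w _ => by omega
  have hXs : ∀ u : Fin n, u ≠ v → s₂.mem (5 * n + u.val) = s.mem (5 * n + u.val) := by
    intro u hu
    have hu' : u.val ≠ v.val := Fin.val_ne_iff.2 hu
    rw [hX, hmem₁, if_neg (by omega), if_neg (by omega)]
  have hYs : ∀ u : Fin n, u ≠ v → s₂.mem (6 * n + u.val) = s.mem (6 * n + u.val) := by
    intro u hu
    have hu' : u.val ≠ v.val := Fin.val_ne_iff.2 hu
    rw [hY, hmem₁, if_neg (by omega), if_neg (by omega)]
  refine ⟨?_, ?_, ?_, ?_, ?_, hk', h5, h6, ?_, ?_, ?_, ?_, ?_, ?_⟩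
  · refine h.consts.of_eq fun i hi i5 i6 i7 => ?_
    rw [hreg₃ i hi i5 i6, h₂.reg i (by omega) i7 (by omega), hreg₁ i hi i7]
  · intro a ha
    rw [hmem₃, hmem a (by omega) fun w _ => by omega, hmem₁, if_neg (by omega), if_neg (by omega),
      h.input a ha]
  · refine List.nodup_append.2 ⟨(hch v).1, hnd.2, ?_⟩
    rintro a ha b hb rfl
    exact hfresh a ha (Or.inr (List.mem_cons_of_mem _ hb))
  · intro u hu
    rw [Finset.mem_insert, not_or]
    rcases List.mem_append.1 hu with hu' | hu'
    · refine ⟨?_, fun h' => hfresh u hu' (Or.inl h')⟩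
      rintro rfl
      exact hfresh u hu' (Or.inr (by simp))
    · refine ⟨?_, h.disjoint u (List.mem_cons_of_mem _ hu')⟩
      rintro rfl
      exact hnd.1 hu'
  · intro u
    have hc := h.cover u
    rw [List.mem_cons] at hc
    rw [Finset.mem_insert, Finset.mem_insert, List.mem_append]
    constructor
    · rintro ((h1 | h1) | h1 | h1)
      · exact (hc.1 (Or.inr (Or.inl h1))).imp id Or.inr
      · exact (hc.1 (Or.inl h1)).imp id Or.inr
      · exact Or.inr (Or.inl (hchild u h1).2)
      · exact (hc.1 (Or.inr (Or.inr h1))).imp id Or.inr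
    · rintro (h1 | h1 | h1)
      · rcases hc.2 (Or.inl h1) with h2 | h2 | h2
        · exact Or.inl (Or.inr h2)
        · exact Or.inl (Or.inl h2)
        · exact Or.inr (Or.inr h2)
      · by_cases hu : u = r
        · rcases hc.2 (Or.inl hu) with h2 | h2 | h2
          · exact Or.inl (Or.inr h2)
          · exact Or.inl (Or.inl h2)
          · exact Or.inr (Or.inr h2)
        · exact Or.inr (Or.inl (((hch v).2 u).2 (h1 ▸ isChild_parent hG hu)))
      · rcases hc.2 (Or.inr h1) with h2 | h2 | h2
        · exact Or.inl (Or.inr h2)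
        · exact Or.inl (Or.inl h2)
        · exact Or.inr (Or.inr h2)
  · rw [hreg₃ 7 (by decide) (by decide) (by decide), hht]
  · rw [hmem₃]
    exact hst
  · intro u hu
    have hun := u.isLt
    rw [hmem₃]
    rcases List.mem_append.1 hu with hu | hu
    · rw [hpar u hu, (hchild u hu).2]
    · rw [hmem _ (by omega), hmem₁, if_neg (by omega), if_neg (by omega),
        h.parents u (List.mem_cons_of_mem _ hu)]
      intro w hw heq
      have : u = w := Fin.ext (by omega)
      subst this
      exact hfresh u hw (Or.inr (List.mem_cons_of_mem _ hu))
  · intro u hu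
    rw [hmem₃]
    by_cases huv : u = v
    · subst huv
      rw [hX, hmem₁, if_neg (by omega), if_pos rfl]
    · rw [hXs u huv, h.abscissas u ((Finset.mem_insert.1 hu).resolve_left huv)]
  · intro u hu
    rw [hmem₃]
    by_cases huv : u = v
    · subst huv
      rw [hY, hmem₁, if_pos rfl]
    · rw [hYs u huv, h.ordinates u ((Finset.mem_insert.1 hu).resolve_left huv)]
  · intro hr
    rcases List.mem_append.1 hr with hr' | hr'
    · exact absurd rfl (hchild r hr').1
    · have hrv : r ≠ v := by
        rintro rfl
        exact hnd.1 hr'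
      rw [hmem₃, hXs r hrv, hYs r hrv]
      exact h.root (List.mem_cons_of_mem _ hr')

/-- A bound for the time that the traversal spends on `v`. -/
noncomputable def cost (G : SimpleGraph (Fin n)) (r : Fin n) (adj : Fin n → List (Fin n)) (N : ℕ)
    (v : Fin n) : ℕ :=
  40 + 13 * (adj v).length + if (childList G r adj v).isEmpty then 21 * Nat.sqrt (N - 1) else 0

/-- If nothing was pushed, `v` is a leaf and uses up its single direction, so the fraction advances;
otherwise the interval of `v` passes to its children and `k` stays. One unit of `cost` is reserved
for the test of the loop. -/
theorem run_traverseBody (hG : G.IsTree) (hadj : IsAdjLists G adj) (hB : 2000 * n ^ 3 ≤ B)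
    (hN : N + 1 ≤ 8 * n) {W : Finset (Fin n)} {S : List (Fin n)} {k : ℕ} {s : State} {v : Fin n}
    (h : TraverseInv G r adj N W (v :: S) k s) :
    Run B traverseBody s (cost G r adj N v - 1) fun s' =>
      ∃ k', TraverseInv G r adj N (insert v W) (childList G r adj v ++ S) k' s' := by
  have hch := isChildLists_childList (r := r) hG hadj
  have hSn : (v :: S).length ≤ n := by simpa using h.nodup.length_le_card
  have hlen : (v :: S).length = S.length + 1 := rfl
  refine .cons 27 ((adj v).length * (12 + 1) + 1 +
    ((if (childList G r adj v).isEmpty then 21 * Nat.sqrt (N - 1) else 0) + 10)) ?_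
    (by rw [cost]; omega)
  refine (run_visitProg hG hadj hB hN h).mono le_rfl ?_
  rintro s₁ ⟨r1, r7, r13, r14, r15, r16, r17, hm⟩
  have hc₁ : Consts n N s₁ := h.consts.of_eq fun i hi _ _ i7 => r1 i hi i7
  have hin₁ : ∀ a < 4 * n, s₁.mem a = (encode adj r).getD a 0 := by
    intro a ha
    rw [hm, if_neg (by omega), if_neg (by omega), h.input a ha]
  refine .cons _ _ ?_ le_rfl
  refine (Run.forLoop (PushInv G r adj v S s₁) (adj v).length 12 ?_ ?_ ?_).mono le_rfl ?_
  · intro i _ s' hs'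
    rw [hs'.index, hs'.reg 17 (by decide) (by decide) (by decide), r17, offset_succ]
    omega
  · intro i hi s' hs'
    exact run_pushBody hG hadj hB (by omega) hc₁ hin₁ r13 r14 hi hs'
  · refine ⟨fun _ _ _ _ => rfl, by simpa using r16, by simpa [pushed] using r7, ?_,
      fun _ _ _ => rfl, by simp [pushed]⟩
    have := h.stack.2
    simp only [pushed, List.take_zero, List.filter_nil, List.reverse_nil, List.nil_append]
    refine this.congr fun a h1 h2 => ?_
    have := v.isLt
    rw [hm, if_neg (by omega), if_neg (by omega)]
  · intro s₂ h₂
    have e15 : s₂.reg 15 = S.length := by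
      rw [h₂.reg 15 (by decide) (by decide) (by decide), r15]
    have e7 : s₂.reg 7 = (childList G r adj v).length + S.length := by
      rw [h₂.height, pushed_length, List.length_append]
    have hreg : ∀ i < 13, i ≠ 7 → s₂.reg i = s.reg i := fun i hi i7 => by
      rw [h₂.reg i (by omega) i7 (by omega), r1 i hi i7]
    have hpl := h.planned
    refine .cons ((if (childList G r adj v).isEmpty then 21 * Nat.sqrt (N - 1) else 0) + 8 + 1) 1
      ?_ (by omega)
    refine .cond (fun hlt => ?_) fun hlt => ?_
    · have hne : (childList G r adj v).isEmpty = false := by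
        cases hl : childList G r adj v with
        | nil => simp [e15, e7, hl] at hlt
        | cons _ _ => rfl
      refine .skip (by omega) (.nil ⟨k, ?_⟩)
      refine h.step hG hadj r1 hm h₂ rfl (fun _ _ _ _ => rfl) ?_ ?_ ?_
      · rw [hreg 5 (by decide) (by decide), h.frac_fst]
      · rw [hreg 6 (by decide) (by decide), h.frac_snd]
      · have := Planned.append_children hG hch (l₁ := []) (l₂ := childList G r adj v) (v := v)
          hpl.2 (by simp) (by rw [leaves_eq hG hch, hne, hpl.1]; simp)
        simpa [hpl.1] using this
    · have hnil : childList G r adj v = [] := by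
        rw [e15, e7] at hlt
        exact List.length_eq_zero_iff.1 (by omega)
      have hs := run_searchProg (s := s₂) (N := N) (k := k) hB hN
        (by rw [hreg 0 (by decide) (by decide), h.consts.zero])
        (by rw [hreg 3 (by decide) (by decide), h.consts.bound])
        (by rw [hreg 4 (by decide) (by decide), h.consts.one])
        (by rw [hreg 5 (by decide) (by decide), h.frac_fst])
        (by rw [hreg 6 (by decide) (by decide), h.frac_snd])
      refine hs.mono (by simp [hnil]) ?_
      rintro s₃ ⟨f1, f2, f5, f6⟩
      refine .nil ⟨k + 1, ?_⟩
      refine h.step hG hadj r1 hm h₂ f1 (fun i hi i5 i6 => f2 i (by omega) i5 i6) f5 f6 ?_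
      have := hpl.2
      rw [leaves_eq hG hch, hnil] at this
      simpa [hnil] using this

/-- The time left is one step for the final test plus the total cost of the unvisited vertices. Once
the stack is empty, `cover` says that `W` contains the root and is closed under children. -/
theorem run_traverse (hG : G.IsTree) (hadj : IsAdjLists G adj) (hB : 2000 * n ^ 3 ≤ B)
    (hN : N + 1 ≤ 8 * n) {s : State} (h : TraverseInv G r adj N ∅ [r] 0 s) :
    Run B (.loop 0 7 traverseBody) s (1 + ∑ v, cost G r adj N v) fun s' => Consts n N s' ∧
      ∀ v : Fin n,
        s'.mem (5 * n + v.val) = (position G r (childList G r adj) (vec N) v).1 ∧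
        s'.mem (6 * n + v.val) = (position G r (childList G r adj) (vec N) v).2 := by
  refine Run.loop (fun τ s => ∃ W S k, TraverseInv G r adj N W S k s ∧
    τ = 1 + ∑ v ∈ Wᶜ, cost G r adj N v) ?_ ?_ ⟨∅, [r], 0, h, by simp⟩
  · rintro τ s ⟨W, S, k, hI, rfl⟩ hlt
    rw [hI.consts.zero, hI.height] at hlt
    cases S with
    | nil => simp at hlt
    | cons v S =>
      refine ⟨_, 1 + ∑ v ∈ (insert v W)ᶜ, cost G r adj N v, ?_,
        (run_traverseBody hG hadj hB hN hI).mono le_rfl ?_⟩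
      · have hv : v ∈ Wᶜ := Finset.mem_compl.2 (hI.disjoint v (by simp))
        rw [Finset.compl_insert, ← Finset.add_sum_erase _ _ hv]
        have : 1 ≤ cost G r adj N v := by rw [cost]; omega
        omega
      · rintro s' ⟨k', hs'⟩
        exact ⟨_, _, k', hs', rfl⟩
  · rintro τ s ⟨W, S, k, hI, rfl⟩ hlt
    refine ⟨by omega, hI.consts, ?_⟩
    rw [hI.consts.zero, hI.height] at hlt
    have hS : S = [] := List.length_eq_zero_iff.1 (by omega)
    subst hS
    have hW : ∀ v, v ∈ W := by
      intro v
      have hc := fun v => hI.cover v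
      simp only [List.not_mem_nil, or_false] at hc
      induction desc_root (r := r) hG v with
      | refl => exact (hc r).2 (Or.inl rfl)
      | tail _ hx ih => exact (hc _).2 (Or.inr (parent_eq hG hx ▸ ih))
    exact fun v => ⟨hI.abscissas v (hW v), hI.ordinates v (hW v)⟩

/-- The degrees sum to `2n - 2`, so the linear part is at most `40n + 26n`; each leaf pays for one
search. -/
theorem sum_cost (hG : G.IsTree) (hadj : IsAdjLists G adj) :
    ∑ v, cost G r adj N v ≤ 66 * n + leafCount G r * (21 * Nat.sqrt (N - 1)) := by
  classical
  have h1 := sum_length_adj adj hG hadj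
  have h2 : leafCount G r = ∑ v, if (childList G r adj v).isEmpty then 1 else 0 := by
    rw [leafCount, Set.ncard_eq_toFinset_card', Finset.card_eq_sum_ones, Finset.sum_ite,
      Finset.sum_const_zero, add_zero]
    apply Finset.sum_congr _ fun _ _ => rfl
    ext v
    simp only [Set.mem_toFinset, Set.mem_ofPred_eq, Finset.mem_filter, Finset.mem_univ, true_and]
    exact (isEmpty_iff_isLeaf (isChildLists_childList hG hadj) v).symm
  simp only [cost, Finset.sum_add_distrib, ← Finset.mul_sum]
  rw [h2, Finset.sum_mul]
  simp only [ite_mul, one_mul, zero_mul, Finset.sum_const, Finset.card_univ, Fintype.card_fin,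
    smul_eq_mul]
  omega

end RAM

/-! ### Counting the leaves and copying the positions -/

namespace RAM

open Fractions RootedTree Drawing

variable {B n N : ℕ} {G : SimpleGraph (Fin n)} {r : Fin n} {adj : Fin n → List (Fin n)}

theorem isLeaf_iff_length_lt_two (hG : G.IsTree) (hadj : IsAdjLists G adj) {v : Fin n}
    (hv : v ≠ r) : IsLeaf G r v ↔ (adj v).length < 2 := by
  have hp := isChild_parent hG hv
  have hlen : (adj v).length < 2 ↔ (adj v).toFinset.card ≤ 1 := by
    rw [List.toFinset_card_of_nodup (hadj v).1]
    omega
  rw [hlen, Finset.card_le_one]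
  simp only [List.mem_toFinset, (hadj v).2, IsLeaf, isChild_iff_adj_and_ne hG]
  constructor
  · intro h
    have : ∀ a, G.Adj v a → a = parent G r v := fun a ha => by
      by_contra hne
      exact h a ⟨ha, hne⟩
    intro a ha b hb
    rw [this a ha, this b hb]
  · rintro h w ⟨h1, h2⟩
    exact h2 (h w h1 _ hp.1.symm)

theorem isLeaf_root_iff (hG : G.IsTree) (hadj : IsAdjLists G adj) :
    IsLeaf G r r ↔ (adj r).length = 0 := by
  rw [List.length_eq_zero_iff, List.eq_nil_iff_forall_not_mem]
  simp only [(hadj r).2, IsLeaf, isChild_iff_adj_and_ne hG, parent_root]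
  exact forall_congr' fun w => ⟨fun h h' => h ⟨h', h'.ne'⟩, fun h h' => h h'.1⟩

/-- The leaves other than the root are the vertices of degree below two. A root of degree one is
among these vertices but has a child, so it is subtracted. In this form the machine can count from
the offsets alone. -/
theorem leafCount_eq (hG : G.IsTree) (hadj : IsAdjLists G adj) :
    leafCount G r = (Finset.univ.filter fun v => (adj v).length < 2).card
      - if (adj r).length < 2 ∧ 0 < (adj r).length then 1 else 0 := by
  classical
  have h1 : leafCount G r = (Finset.univ.filter fun v => IsLeaf G r v).card := by
    rw [leafCount, Set.ncard_eq_toFinset_card']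
    congr 1
    ext v
    simp
  have h2 : (Finset.univ.filter fun v => IsLeaf G r v).erase r
      = (Finset.univ.filter fun v => (adj v).length < 2).erase r := by
    ext v
    simp only [Finset.mem_erase, Finset.mem_filter, Finset.mem_univ, true_and]
    exact and_congr_right fun hv => isLeaf_iff_length_lt_two hG hadj hv
  have h3 := congrArg Finset.card h2
  rw [Finset.card_erase_eq_ite, Finset.card_erase_eq_ite, ← h1] at h3
  simp only [Finset.mem_filter, Finset.mem_univ, true_and, isLeaf_root_iff hG hadj] at h3
  have h4 := leafCount_pos (r := r) hG
  have h5 : (adj r).length < 2 → 0 < (Finset.univ.filter fun v => (adj v).length < 2).card :=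
    fun h => Finset.card_pos.2 ⟨r, by simpa using h⟩
  split_ifs at h3 ⊢ <;> omega

/-- `R 17` becomes the degree of the vertex `R j`, and `R 20` becomes `2`. -/
def degreeProg (j : ℕ) : Prog := block [
  .const 19 2, .op .add 19 19 j, .load 16 19, .op .add 19 19 4, .load 17 19, .op .sub 17 17 16,
  .const 20 2]

theorem run_degreeProg (hG : G.IsTree) (hadj : IsAdjLists G adj) (hB : 2000 * n ^ 3 ≤ B)
    {j : ℕ} (hj : j ≤ 13) {s : State} {v : Fin n} (h4 : s.reg 4 = 1) (hv : s.reg j = v.val)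
    (hin : s.mem = fun a => (encode adj r).getD a 0) :
    Run B (degreeProg j) s 8 fun s' => s'.mem = s.mem ∧ (∀ i < 16, s'.reg i = s.reg i) ∧
      s'.reg 17 = (adj v).length ∧ s'.reg 20 = 2 := by
  have hvn := v.isLt
  have hn : 1 ≤ n := by omega
  have hn2 : n ≤ n ^ 3 := Nat.le_self_pow (by norm_num) n
  have o1 := offset_succ adj v
  have o2 := offset_le hG hadj (k := v.val + 1) (by omega)
  refine .consConst (by omega) ?_
  refine .consOp (2 + v.val) (by simp [BinOp.eval, hv, show j ≠ 19 by omega]) (by omega) ?_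
  refine .consLoad (offset adj v.val) ?_ (by omega) ?_
  · simp only [State.reg_setReg, if_true, State.mem_setReg, hin]
    rw [encode_offset adj r (by omega)]
  refine .consOp (2 + (v.val + 1)) (by simp [BinOp.eval, h4, add_assoc]) (by omega) ?_
  refine .consLoad (offset adj (v.val + 1)) ?_ (by omega) ?_
  · simp only [State.reg_setReg, if_true, State.mem_setReg, hin]
    rw [encode_offset adj r (by omega)]
  refine .consOp (adj v).length (by simp [BinOp.eval, o1]) (by omega) ?_
  refine .consConst (by omega) ?_
  refine .nil ⟨rfl, fun i hi => ?_, by simp, by simp⟩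
  simp [show i ≠ 16 by omega, show i ≠ 17 by omega, show i ≠ 19 by omega, show i ≠ 20 by omega]

/-- Add `1` to `R 3` if the vertex `R 13` has degree at most one, and go to the next vertex. -/
def countBody : Prog := block [
  degreeProg 13, .cond 17 20 (.op .add 3 3 4) .skip, .op .add 13 13 4]

/-- Compute the bound for the coordinates from the number of leaves. -/
def boundProg : Prog := block [
  .const 4 1, .load 1 0, .load 2 4, .loop 13 1 countBody,
  degreeProg 2, .cond 17 20 (.cond 0 17 (.op .sub 3 3 4) .skip) .skip,
  .const 20 13, .op .mul 3 3 20, .const 20 2, .op .div 3 3 20]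

/-- The number of vertices below `i` of degree at most one. -/
def smallDegreeCount (adj : Fin n → List (Fin n)) (i : ℕ) : ℕ :=
  (Finset.univ.filter fun v : Fin n => v.val < i ∧ (adj v).length < 2).card

theorem smallDegreeCount_le (i : ℕ) : smallDegreeCount adj i ≤ n :=
  (Finset.card_le_univ _).trans (by simp)

theorem smallDegreeCount_succ (v : Fin n) : smallDegreeCount adj (v.val + 1)
    = smallDegreeCount adj v.val + if (adj v).length < 2 then 1 else 0 := by
  have h : (Finset.univ.filter fun u : Fin n => u.val < v.val + 1 ∧ (adj u).length < 2)
      = if (adj v).length < 2 then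
          insert v (Finset.univ.filter fun u : Fin n => u.val < v.val ∧ (adj u).length < 2)
        else Finset.univ.filter fun u : Fin n => u.val < v.val ∧ (adj u).length < 2 := by
    split_ifs with hv
    · ext u
      simp only [Finset.mem_filter, Finset.mem_univ, true_and, Finset.mem_insert]
      by_cases huv : u = v
      · simp [huv, hv]
      · have : u.val ≠ v.val := Fin.val_ne_iff.2 huv
        simp only [huv, false_or]
        exact and_congr_left fun _ => by omega
    · ext u
      simp only [Finset.mem_filter, Finset.mem_univ, true_and]
      by_cases huv : u = v
      · simp [huv, hv]
      · have : u.val ≠ v.val := Fin.val_ne_iff.2 huv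
        exact and_congr_left fun _ => by omega
  rw [smallDegreeCount, h, smallDegreeCount]
  split_ifs
  · exact Finset.card_insert_of_notMem (by simp)
  · rfl

theorem run_boundProg (hG : G.IsTree) (hadj : IsAdjLists G adj) (hB : 2000 * n ^ 3 ≤ B) :
    Run B boundProg (State.init (encode adj r)) (13 * n + 30) fun s =>
      s.mem = (State.init (encode adj r)).mem ∧ s.reg 0 = 0 ∧ s.reg 1 = n ∧ s.reg 2 = r.val ∧
      s.reg 3 = coordBound G r ∧ s.reg 4 = 1 ∧ s.reg 6 = 0 := by
  have hrn := r.isLt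
  have hn : 1 ≤ n := by omega
  have hn2 : n ≤ n ^ 3 := Nat.le_self_pow (by norm_num) n
  refine .consConst (by omega) ?_
  -- The values `0` and `1` of `R 0` and `R 4` serve as the addresses of `n` and of the root.
  refine .consLoad n (by simpa [State.init] using encode_zero adj r) (by omega) ?_
  refine .consLoad r.val (by simpa [State.init] using encode_one adj r) (by omega) ?_
  refine .cons (n * (12 + 1) + 1) 20 ?_ (by omega)
  refine (Run.forLoop (fun i s => s.mem = (State.init (encode adj r)).mem ∧ s.reg 0 = 0 ∧
    s.reg 1 = n ∧ s.reg 2 = r.val ∧ s.reg 3 = smallDegreeCount adj i ∧ s.reg 4 = 1 ∧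
    s.reg 6 = 0 ∧ s.reg 13 = i) n 12 ?_ ?_ ?_).mono le_rfl ?_
  · rintro i - s ⟨-, -, h1, -, -, -, -, h13⟩
    rw [h1, h13]
  · rintro i hi s ⟨hm, h0, h1, h2, h3, h4, h6, h13⟩
    refine .cons 8 4 ((run_degreeProg hG hadj hB (j := 13) (by omega) (v := ⟨i, hi⟩) h4 h13
      hm).mono le_rfl ?_) (by omega)
    rintro s' ⟨f1, f2, f3, f4⟩
    have hc := smallDegreeCount_succ (adj := adj) ⟨i, hi⟩
    simp only at hc
    have hle := smallDegreeCount_le (adj := adj) i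
    have hend : ∀ s'' : State, s''.mem = s'.mem →
        (∀ j < 16, j ≠ 3 → s''.reg j = s'.reg j) →
        s''.reg 3 = smallDegreeCount adj (i + 1) →
        Run B (block [.op .add 13 13 4]) s'' 2 fun s =>
          s.mem = (State.init (encode adj r)).mem ∧ s.reg 0 = 0 ∧
          s.reg 1 = n ∧ s.reg 2 = r.val ∧ s.reg 3 = smallDegreeCount adj (i + 1) ∧ s.reg 4 = 1 ∧
          s.reg 6 = 0 ∧ s.reg 13 = i + 1 := by
      intro s'' g1 g2 g3
      refine .consOp (i + 1) (by simp [BinOp.eval, g2, f2, h13, h4]) (by omega) ?_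
      refine .nil ⟨?_, ?_, ?_, ?_, ?_, ?_, ?_, ?_⟩
      · rw [State.mem_setReg, g1, f1, hm]
      all_goals simp [g2, f2, g3, h0, h1, h2, h4, h6]
    refine .cons 2 2 (.cond (fun hlt => ?_) fun hlt => ?_) (by omega)
    · rw [f3, f4] at hlt
      rw [if_pos hlt] at hc
      refine .op (by omega) (smallDegreeCount adj (i + 1))
        (by simp [BinOp.eval, f2, h3, h4, hc]) (by omega) (hend _ rfl (fun j _ hj => ?_) ?_)
      · simp [hj]
      · simp
    · rw [f3, f4] at hlt
      rw [if_neg hlt] at hc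
      exact .skip (by omega) (hend _ rfl (fun j _ _ => rfl) (by simp [f2, h3, hc]))
  · refine ⟨rfl, by simp [State.init], by simp, by simp, ?_, by simp, by simp [State.init],
      by simp [State.init]⟩
    simp [State.init, smallDegreeCount]
  · rintro s ⟨hm, h0, h1, h2, h3, h4, h6, -⟩
    have hcount : leafCount G r = smallDegreeCount adj n
        - if (adj r).length < 2 ∧ 0 < (adj r).length then 1 else 0 := by
      rw [leafCount_eq hG hadj, smallDegreeCount]
      simp
    have hle := smallDegreeCount_le (adj := adj) n
    refine .cons 8 12 ((run_degreeProg hG hadj hB (j := 2) (by omega) (v := r) h4 h2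
      hm).mono le_rfl ?_) (by omega)
    rintro s' ⟨f1, f2, f3, f4⟩
    have hend : ∀ s'' : State, s''.mem = s'.mem →
        (∀ j < 16, j ≠ 3 → s''.reg j = s'.reg j) → s''.reg 3 = leafCount G r →
        Run B (block [.const 20 13, .op .mul 3 3 20, .const 20 2, .op .div 3 3 20]) s'' 5 fun s =>
          s.mem = (State.init (encode adj r)).mem ∧ s.reg 0 = 0 ∧ s.reg 1 = n ∧
          s.reg 2 = r.val ∧ s.reg 3 = coordBound G r ∧ s.reg 4 = 1 ∧ s.reg 6 = 0 := by
      intro s'' g1 g2 g3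
      refine .consConst (by omega) ?_
      refine .consOp (13 * leafCount G r) (by simp [BinOp.eval, g3, mul_comm]) (by omega) ?_
      refine .consConst (by omega) ?_
      refine .consOp (coordBound G r) (by simp [BinOp.eval, coordBound])
        (by rw [coordBound]; omega) ?_
      refine .nil ⟨?_, ?_, ?_, ?_, ?_, ?_, ?_⟩
      · simp only [State.mem_setReg]
        rw [g1, f1, hm]
      all_goals simp [g2, f2, h0, h1, h2, h4, h6]
    refine .cons 3 5 (.cond (fun hlt => .cond (fun hlt' => ?_) fun hlt' => ?_) fun hlt => ?_)
      (by omega)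
    · rw [f3, f4] at hlt
      rw [f3, f2 0 (by decide), h0] at hlt'
      rw [if_pos ⟨hlt, hlt'⟩] at hcount
      refine .op (by omega) (leafCount G r) (by simp [BinOp.eval, f2, h3, h4, hcount])
        (by omega) (hend _ rfl (fun j _ hj => ?_) ?_)
      · simp [hj]
      · simp
    · rw [f3, f2 0 (by decide), h0] at hlt'
      rw [if_neg fun h => hlt' h.2] at hcount
      exact .skip (by omega) (hend _ rfl (fun j _ _ => rfl) (by simp [f2, h3, hcount]))
    · rw [f3, f4] at hlt
      rw [if_neg fun h => hlt h.1] at hcount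
      exact .skip (by omega) (hend _ rfl (fun j _ _ => rfl) (by simp [f2, h3, hcount]))

/-- Initialize the addresses, the fraction `0 / 1`, and the stack, which holds the root. -/
def startProg : Prog := block [
  .op .add 8 1 1, .op .add 8 8 8, .op .add 9 8 1, .op .add 10 9 1, .op .add 11 10 1,
  .const 20 3, .op .add 12 1 20, .const 5 1, .const 7 1, .store 11 2,
  .op .add 19 8 2, .store 19 2, .op .add 19 9 2, .store 19 0, .op .add 19 10 2, .store 19 0]

theorem run_startProg (hB : 2000 * n ^ 3 ≤ B) {s : State}
    (hm : s.mem = (State.init (encode adj r)).mem) (h0 : s.reg 0 = 0) (h1 : s.reg 1 = n)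
    (h2 : s.reg 2 = r.val) (h3 : s.reg 3 = N) (h4 : s.reg 4 = 1) (h6 : s.reg 6 = 0) :
    Run B startProg s 17 (TraverseInv G r adj N ∅ [r] 0) := by
  have hrn := r.isLt
  have hn : 1 ≤ n := by omega
  have hn2 : n ≤ n ^ 3 := Nat.le_self_pow (by norm_num) n
  refine .consOp (2 * n) (by simp [BinOp.eval, h1, two_mul]) (by omega) ?_
  refine .consOp (4 * n) (by simp [BinOp.eval]; omega) (by omega) ?_
  refine .consOp (5 * n) (by simp [BinOp.eval, h1]; omega) (by omega) ?_
  refine .consOp (6 * n) (by simp [BinOp.eval, h1]; omega) (by omega) ?_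
  refine .consOp (7 * n) (by simp [BinOp.eval, h1]; omega) (by omega) ?_
  refine .consConst (by omega) ?_
  refine .consOp (n + 3) (by simp [BinOp.eval, h1]) (by omega) ?_
  refine .consConst (by omega) ?_
  refine .consConst (by omega) ?_
  refine .consStore (7 * n) r.val (by simp) (by simp [h2]) (by omega) ?_
  refine .consOp (4 * n + r.val) (by simp [BinOp.eval, h2]) (by omega) ?_
  refine .consStore (4 * n + r.val) r.val (by simp) (by simp [h2]) (by omega) ?_
  refine .consOp (5 * n + r.val) (by simp [BinOp.eval, h2]) (by omega) ?_
  refine .consStore (5 * n + r.val) 0 (by simp) (by simp [h0]) (by omega) ?_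
  refine .consOp (6 * n + r.val) (by simp [BinOp.eval, h2]) (by omega) ?_
  refine .consStore (6 * n + r.val) 0 (by simp) (by simp [h0]) (by omega) ?_
  refine .nil ⟨⟨?_, ?_, ?_, ?_, ?_, ?_, ?_, ?_, ?_⟩, ?_, ?_, ?_, ?_, ?_, ?_, ?_, ?_, ?_, ?_, ?_,
    ?_, ?_⟩
  · simp [h0]
  · simp [h1]
  · simp [h3]
  · simp [h4]
  · simp
  · simp
  · simp
  · simp
  · simp
  · intro a ha
    simp [show a ≠ 6 * n + r.val by omega, show a ≠ 5 * n + r.val by omega,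
      show a ≠ 4 * n + r.val by omega, show a ≠ 7 * n by omega, hm, State.init]
  · simp
  · simp
  · simp
  · exact ⟨firstLeaf_root _, trivial⟩
  · simp [enum]
  · simp [enum, h6]
  · simp
  · refine ⟨?_, trivial⟩
    simp [show 7 * n ≠ 6 * n + r.val by omega, show 7 * n ≠ 5 * n + r.val by omega,
      show 7 * n ≠ 4 * n + r.val by omega]
  · simp only [List.mem_singleton]
    rintro v rfl
    simp [parent_root, show n ≠ 0 by omega]
  · simp
  · simp
  · intro _
    simp

/-- Copy the position of the vertex `R 13` to the output. -/
def copyBody : Prog := block [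
  .op .add 19 9 13, .load 20 19, .op .add 21 13 13, .store 21 20,
  .op .add 19 10 13, .load 20 19, .op .add 21 21 4, .store 21 20, .op .add 13 13 4]

/-- The output overwrites cells below `2n`, which hold input that is no longer needed, while the
coordinates are read from `5n` on. -/
theorem run_copy (hB : 2000 * n ^ 3 ≤ B) {s : State} (hc : Consts n N s) (h13 : s.reg 13 = 0)
    {P : Fin n → ℕ × ℕ} (hP : ∀ v, (P v).1 ≤ 128 * n ^ 3 ∧ (P v).2 ≤ 128 * n ^ 3)
    (hs : ∀ v : Fin n, s.mem (5 * n + v.val) = (P v).1 ∧ s.mem (6 * n + v.val) = (P v).2) :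
    Run B (.loop 13 1 copyBody) s (n * (10 + 1) + 1) fun s' =>
      ∀ v : Fin n, s'.mem (2 * v.val) = (P v).1 ∧ s'.mem (2 * v.val + 1) = (P v).2 := by
  refine (Run.forLoop (fun i s' => (∀ j < 13, s'.reg j = s.reg j) ∧ s'.reg 13 = i ∧
    (∀ a, 2 * n ≤ a → s'.mem a = s.mem a) ∧
    ∀ v : Fin n, v.val < i → s'.mem (2 * v.val) = (P v).1 ∧ s'.mem (2 * v.val + 1) = (P v).2)
    n 10 ?_ ?_ ⟨fun _ _ => rfl, h13, fun _ _ => rfl, fun _ h => by omega⟩).mono le_rfl ?_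
  · rintro i - s' ⟨f1, f2, -⟩
    rw [f1 1 (by decide), f2, hc.size]
  · rintro i hi s' ⟨f1, f2, f3, f4⟩
    have hn2 : n ≤ n ^ 3 := Nat.le_self_pow (by norm_num) n
    obtain ⟨p1, p2⟩ := hP ⟨i, hi⟩
    obtain ⟨q1, q2⟩ := hs ⟨i, hi⟩
    simp only at q1 q2
    refine .consOp (5 * n + i) (by simp [BinOp.eval, f1, f2, hc.abscissas]) (by omega) ?_
    refine .consLoad (P ⟨i, hi⟩).1 ?_ (by omega) ?_
    · simp only [State.reg_setReg, if_true, State.mem_setReg]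
      rw [f3 _ (by omega), q1]
    refine .consOp (2 * i) (by simp [BinOp.eval, f2, two_mul]) (by omega) ?_
    refine .consStore (2 * i) (P ⟨i, hi⟩).1 (by simp) (by simp) (by omega) ?_
    refine .consOp (6 * n + i) (by simp [BinOp.eval, f1, f2, hc.ordinates]) (by omega) ?_
    refine .consLoad (P ⟨i, hi⟩).2 ?_ (by omega) ?_
    · simp [show 6 * n + i ≠ 2 * i by omega]
      rw [f3 _ (by omega), q2]
    refine .consOp (2 * i + 1) (by simp [BinOp.eval, f1, hc.one]) (by omega) ?_
    refine .consStore (2 * i + 1) (P ⟨i, hi⟩).2 (by simp) (by simp) (by omega) ?_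
    refine .consOp (i + 1) (by simp [BinOp.eval, f1, f2, hc.one]) (by omega) ?_
    refine .nil ⟨fun j hj => ?_, by simp, fun a ha => ?_, fun v hv => ?_⟩
    · simp [f1 j hj, show j ≠ 13 by omega, show j ≠ 19 by omega, show j ≠ 20 by omega,
        show j ≠ 21 by omega]
    · simp [show a ≠ 2 * i + 1 by omega, show a ≠ 2 * i by omega, f3 a ha]
    · by_cases hvi : v = ⟨i, hi⟩
      · subst hvi
        simp
      · have hne : v.val ≠ i := fun h => hvi (Fin.ext h)
        obtain ⟨g1, g2⟩ := f4 v (by omega)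
        simp only [State.mem_setReg, State.mem_setMem]
        rw [if_neg (by omega), if_neg (by omega), if_neg (by omega), if_neg (by omega)]
        exact ⟨g1, g2⟩
  · rintro s' ⟨-, -, -, f4⟩ v
    exact f4 v v.isLt

/-- Compute the drawing of a rooted tree. -/
def drawProg : Prog := block [
  boundProg, startProg, .loop 0 7 traverseBody, .const 13 0, .loop 13 1 copyBody]

theorem coordBound_lt (hG : G.IsTree) : coordBound G r + 1 ≤ 8 * n := by
  have h1 : leafCount G r ≤ n := by
    have : leafCount G r ≤ Fintype.card (Fin n) := by
      rw [← Nat.card_eq_fintype_card]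
      exact Set.ncard_le_card _
    simpa using this
  have h2 := leafCount_pos (r := r) hG
  rw [coordBound]
  omega

/-- The parts add up to at most `90n + 51` steps besides the searches, and `n ≥ 1` absorbs the
constant. -/
theorem run_drawProg (hG : G.IsTree) (hadj : IsAdjLists G adj) (hB : 2000 * n ^ 3 ≤ B) :
    Run B drawProg (State.init (encode adj r))
      (142 * n + leafCount G r * (21 * Nat.sqrt (coordBound G r - 1))) fun s =>
        (s.output : Fin n → ℤ × ℤ) = gridPos G r (childList G r adj) := by
  have hrn := r.isLt
  have hn2 : n ≤ n ^ 3 := Nat.le_self_pow (by norm_num) n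
  have hN := coordBound_lt (r := r) hG
  have hcost := sum_cost (r := r) (N := coordBound G r) hG hadj
  refine .cons (13 * n + 30) (17 + ((1 + ∑ v, cost G r adj (coordBound G r) v)
    + (n * (10 + 1) + 3))) ?_ (by omega)
  refine (run_boundProg hG hadj hB).mono le_rfl ?_
  rintro s ⟨hm, h0, h1, h2, h3, h4, h6⟩
  refine .cons _ _ ((run_startProg (G := G) hB hm h0 h1 h2 h3 h4 h6).mono le_rfl ?_) le_rfl
  intro s hs
  refine .cons _ _ ((run_traverse hG hadj hB hN hs).mono le_rfl ?_) le_rfl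
  rintro s ⟨hc, hpos⟩
  refine .consConst (by omega) ?_
  refine .cons (n * (10 + 1) + 1) 1 ((run_copy (N := coordBound G r) (s := s.setReg 13 0) hB
    ?_ (by simp)
    (P := position G r (childList G r adj) (vec (coordBound G r)))
    (position_vec_le hG hN _) hpos).mono le_rfl ?_) (by omega)
  · exact hc.of_eq fun i hi _ _ _ => by simp [show i ≠ 13 by omega]
  · intro s hs
    refine .nil (funext fun v => ?_)
    simp [State.output, gridPos, hs v]

/-- `13t / 2 ≤ 9t` makes the square root at most `3 √t`, and `63 = 21 · 3`. -/
theorem mul_sqrt_le_rpow (t : ℕ) :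
    ((t * (21 * Nat.sqrt (13 * t / 2 - 1)) : ℕ) : ℝ) ≤ 63 * (t : ℝ) ^ (3 / 2 : ℝ) := by
  have h1 : ((Nat.sqrt (13 * t / 2 - 1) : ℕ) : ℝ) ≤ 3 * Real.sqrt t := by
    have h2 : Nat.sqrt (13 * t / 2 - 1) * Nat.sqrt (13 * t / 2 - 1) ≤ 9 * t :=
      (Nat.sqrt_le _).trans (by omega)
    have h3 : ((Nat.sqrt (13 * t / 2 - 1) : ℕ) : ℝ) ^ 2 ≤ 9 * t := by
      rw [sq]
      exact_mod_cast h2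
    calc ((Nat.sqrt (13 * t / 2 - 1) : ℕ) : ℝ) ≤ Real.sqrt (9 * t) := Real.le_sqrt_of_sq_le h3
      _ = 3 * Real.sqrt t := by
        rw [Real.sqrt_mul (by norm_num), show (9 : ℝ) = 3 ^ 2 by norm_num,
          Real.sqrt_sq (by norm_num)]
  have h4 : (t : ℝ) ^ (3 / 2 : ℝ) = t * Real.sqrt t := by
    rcases Nat.eq_zero_or_pos t with rfl | ht
    · simp
    · rw [show (3 / 2 : ℝ) = 1 + 1 / 2 by norm_num, Real.rpow_add (by exact_mod_cast ht),
        Real.rpow_one, Real.sqrt_eq_rpow]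
  rw [h4]
  push_cast
  have ht : (0 : ℝ) ≤ t := by positivity
  nlinarith [mul_le_mul_of_nonneg_left h1 ht]

end RAM

theorem mainTheorem2 :
    -- every rooted tree has a truly integral Fáry embedding on the grid
    (∀ (V : Type u) [Fintype V] (G : SimpleGraph V) (r : V), G.IsTree →
      ∃ pos : V → ℤ × ℤ, Drawing.IsTrulyIntegralFary G pos ∧
        Drawing.OnGrid pos
          (max 1 (2 * Real.pi ^ 2 / 3 * RootedTree.leafCount G r * RootedTree.depth G r))
          (max 1 (2 * Real.pi ^ 2 / 3 * RootedTree.leafCount G r * RootedTree.depth G r))) ∧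
    -- the grid has size `O(n²) × O(n²)`
    (∃ K : ℝ, ∀ (V : Type u) [Fintype V] (G : SimpleGraph V) (r : V), G.IsTree →
      max 1 (2 * Real.pi ^ 2 / 3 * RootedTree.leafCount G r * RootedTree.depth G r)
        ≤ K * (Fintype.card V : ℝ) ^ 2) ∧
    -- one program finds such an embedding in time `O(n + t^(3/2))`, with words of `O(log n)` bits
    (∃ (p : RAM.Prog) (C D : ℕ), ∀ (n : ℕ) (G : SimpleGraph (Fin n)) (r : Fin n)
      (adj : Fin n → List (Fin n)), G.IsTree → RAM.IsAdjLists G adj →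
      ∃ (s : RAM.State) (T : ℕ),
        RAM.Exec (D * n ^ D) p (RAM.State.init (RAM.encode adj r)) s T ∧
        (T : ℝ) ≤ C * ((n : ℝ) + (RootedTree.leafCount G r : ℝ) ^ (3 / 2 : ℝ)) ∧
        Drawing.IsTrulyIntegralFary G (s.output : Fin n → ℤ × ℤ) ∧
        Drawing.OnGrid (s.output : Fin n → ℤ × ℤ)
          (max 1 (2 * Real.pi ^ 2 / 3 * RootedTree.leafCount G r * RootedTree.depth G r))
          (max 1 (2 * Real.pi ^ 2 / 3 * RootedTree.leafCount G r * RootedTree.depth G r))) := by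
  -- `142` covers the linear part and exceeds the factor `63` of the searches. In `D * n ^ D` the
  -- number `2000` is needed as a factor; as an exponent it merely has to be at least `3`.
  refine ⟨?_, ⟨11, fun V _ G r hG => Drawing.gridSize_le hG⟩, RAM.drawProg, 142, 2000, ?_⟩
  · intro V _ G r hG
    obtain ⟨ch, hch⟩ := RootedTree.exists_isChildLists G r
    exact ⟨Drawing.gridPos G r ch, Drawing.isTrulyIntegralFary_gridPos hG hch,
      Drawing.onGrid_gridPos hG hch⟩
  · intro n G r adj hG hadj
    have hch := RAM.isChildLists_childList (r := r) hG hadj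
    have hn : 1 ≤ n := by
      have := r.isLt
      omega
    have hB : ∀ D, 3 ≤ D → 2000 * n ^ 3 ≤ 2000 * n ^ D := fun D hD =>
      Nat.mul_le_mul_left _ (Nat.pow_le_pow_right hn hD)
    obtain ⟨s, T, h1, h2, h3⟩ := RAM.run_drawProg (r := r) hG hadj (hB 2000 (by norm_num))
    refine ⟨s, T, h1, ?_, ?_, ?_⟩
    · have h4 := RAM.mul_sqrt_le_rpow (RootedTree.leafCount G r)
      have h5 : (T : ℝ) ≤ 142 * n + ((RootedTree.leafCount G r *
          (21 * Nat.sqrt (13 * RootedTree.leafCount G r / 2 - 1)) : ℕ) : ℝ) := by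
        exact_mod_cast h2
      have h6 : (0 : ℝ) ≤ (RootedTree.leafCount G r : ℝ) ^ (3 / 2 : ℝ) := by positivity
      push_cast at h4 h5 ⊢
      linarith
    · rw [h3]
      exact Drawing.isTrulyIntegralFary_gridPos hG hch
    · rw [h3]
      exact Drawing.onGrid_gridPos hG hch
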